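/- Let $0<\rho<1$ and $T>0$. Let $D([0,T],\mathcal S'(\mathbb R))$ be the space of right-continuous paths with left limits in the space of real tempered distributions. Let $C_c^{1,2}([0,T]\times\mathbb R)$ be the space of compactly supported functions $G(s,u)$ on $[0,T]\times\mathbb R$ that are once continuously differentiable in $s$ and twice in $u$, and write $G_s=G(s,\cdot)$. For $\mu\in D([0,T],\mathcal S'(\mathbb R))$ and $G\in C_c^{1,2}([0,T]\times\mathbb R)$ put $$l(\mu,G)=\langle\mu_T,G_T\rangle-\langle\mu_0,G_0\rangle-\int_0^T\big\langle\mu_s,(\partial_s+\tfrac12\partial_u^2)G_s\big\rangle\,ds ,$$ and define $\mathcal Q(\mu)=\mathcal Q_{dyn}(\mu)+\mathcal Q_0(\mu_0)\in[0,\infty]$, where $$\mathcal Q_{dyn}(\mu)=\sup_{G\in C_c^{1,2}([0,T]\times\mathbb R)}\Big\{l(\mu,G)-\frac{\rho(1-\rho)}2\int_0^T\!\!\int_{\mathbb R}(\partial_uG)^2\,du\,ds\Big\},\qquad \mathcal Q_0(\mu_0)=\sup_{\phi\in C_c(\mathbb R)}\Big\{\langle\mu_0,\phi\rangle-\frac{\rho(1-\rho)}2\int_{\mathbb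 R}\phi^2\,du\Big\}.$$ Here, for a compactly supported continuous function $g$, the pairing $\langle\nu,g\rangle$ is the value of $\nu$ at $g$ if $g$ is a Schwartz function, it is $\int fg\,du$ if $\nu$ is given by a locally integrable function $f$ (the two agree when both apply), and it is $0$ by convention otherwise (this convention does not affect $\mathcal Q$). For $\alpha\in\mathbb R$ let $$\mathbb J(\alpha)=\inf\big\{\mathcal Q(\mu):\mu_T(\chi_{[0,\infty)})-\mu_0(\chi_{[0,\infty)})=\alpha\big\},\qquad \mathbb I(\alpha)=\inf\big\{\mathcal Q(\mu):\mu_T(\chi_{[0,\infty)})-\mu_0(\chi_{[0,\infty)})=\rho\alpha\big\},$$ the infima being over $\mu\in D([0,T],\mathcal S'(\mathbb R))$. The constraint $\mu_T(\chi_{[0,\infty)})-\mu_0(\chi_{[0,\infty)})=a$ means that $\mu_T$ and $\mu_0$ are given by locally integrable functions and that $\lim_{n\to\infty}\big(\langle\mu_T,G_n\rangle-\langle\mu_0,G_n\rangle\big)=a$, where $G_n(u)=\chi_{[0,\infty)}(u)\,(1-u/n)^+$ and $\langle\nu,G_n\rangle=\int fG_n\,du$ when $\nu$ is given by $f$. ($\mathbb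 J$ and $\mathbb I$ are the moderate deviation rate functions of the current through the origin and of the position of the tagged particle in the one-dimensional symmetric simple exclusion process with density $\rho$, over the time horizon $T$.) Then, for every $\alpha\in\mathbb R$, $$\mathbb J(\alpha)=\frac{\sqrt{2\pi}\,\alpha^2}{4\rho(1-\rho)\sqrt T},\qquad \mathbb I(\alpha)=\frac{\sqrt{2\pi}\,\rho\,\alpha^2}{4(1-\rho)\sqrt T}.$$ -/

import Mathlib

open MeasureTheory Filter Topology Set
open scoped SchwartzMap

noncomputable section

namespace ExclusionMDP

/-- Real tempered distributions on the line, with the topology of pointwise convergence on Schwartz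
functions. -/
abbrev TDist : Type := 𝓢(ℝ, ℝ) →Lₚₜ[ℝ] ℝ

/-- The path `μ` restricted to `[0, T]` belongs to `D([0, T], 𝓢')`: it is right-continuous on
`[0, T)` and has left limits on `(0, T]`. The values of `μ` outside `[0, T]` play no role. -/
def IsCadlag (T : ℝ) (μ : ℝ → TDist) : Prop :=
  (∀ t ∈ Ico 0 T, Tendsto μ (𝓝[>] t) (𝓝 (μ t))) ∧
    ∀ t ∈ Ioc 0 T, ∃ ν : TDist, Tendsto μ (𝓝[<] t) (𝓝 ν)

/-- The tempered distribution `ν` is given by the locally integrable function `f`. -/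
def IsDensity (ν : TDist) (f : ℝ → ℝ) : Prop :=
  LocallyIntegrable f ∧
    ∀ φ : 𝓢(ℝ, ℝ), HasCompactSupport φ → ν φ = ∫ u, f u * φ u

open Classical in
/-- The pairing `⟨ν, g⟩` of a tempered distribution with a compactly supported continuous function
`g`. If `g` is a Schwartz function, it is the value of `ν` at `g`; if `ν` is given by a locally
integrable function `f`, it is `∫ f g`. The two agree when both apply. If neither applies the
pairing has no meaning and the value `0` is a convention. -/
def pairing (ν : TDist) (g : ℝ → ℝ) : ℝ :=
  if h : ∃ φ : 𝓢(ℝ, ℝ), ⇑φ = g then ν h.choose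
  else if h : ∃ f : ℝ → ℝ, IsDensity ν f then ∫ u, h.choose u * g u
  else 0

/-- The class `C_c^{1,2}`: compactly supported functions of `(s, u)`, once continuously
differentiable in `s` and twice in `u`. The elements of `C_c^{1,2}([0, T] × ℝ)` are the restrictions
to `[0, T] × ℝ` of these functions (they need not vanish at `s = 0` or `s = T`). -/
structure IsTest (G : ℝ → ℝ → ℝ) : Prop where
  compact : HasCompactSupport fun p : ℝ × ℝ => G p.1 p.2
  cont : Continuous fun p : ℝ × ℝ => G p.1 p.2
  diff_time : ∀ u, Differentiable ℝ fun s => G s u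
  cont_time : Continuous fun p : ℝ × ℝ => deriv (fun s => G s p.2) p.1
  diff_space : ∀ s, ContDiff ℝ 2 (G s)
  cont_space : Continuous fun p : ℝ × ℝ => deriv (G p.1) p.2
  cont_space_two : Continuous fun p : ℝ × ℝ => iteratedDeriv 2 (G p.1) p.2

/-- The linear functional `l(μ, G) = ⟨μ_T, G_T⟩ - ⟨μ_0, G_0⟩ - ∫_0^T ⟨μ_s, (∂_s + ½ ∂_u²) G_s⟩ ds`. -/
def linPart (T : ℝ) (μ : ℝ → TDist) (G : ℝ → ℝ → ℝ) : ℝ :=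
  pairing (μ T) (G T) - pairing (μ 0) (G 0) -
    ∫ s in (0 : ℝ)..T,
      pairing (μ s) fun u => deriv (fun r => G r u) s + (1 / 2) * iteratedDeriv 2 (G s) u

/-- The dynamical part of the rate function. -/
def Qdyn (ρ T : ℝ) (μ : ℝ → TDist) : EReal :=
  ⨆ (G : ℝ → ℝ → ℝ) (_ : IsTest G),
    ((linPart T μ G -
      ρ * (1 - ρ) / 2 * ∫ s in (0 : ℝ)..T, ∫ u, (deriv (G s) u) ^ 2 : ℝ) : EReal)

/-- The static part of the rate function. -/
def Qzero (ρ : ℝ) (ν : TDist) : EReal :=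
  ⨆ (φ : ℝ → ℝ) (_ : Continuous φ ∧ HasCompactSupport φ),
    ((pairing ν φ - ρ * (1 - ρ) / 2 * ∫ u, (φ u) ^ 2 : ℝ) : EReal)

/-- The moderate deviation rate function of the empirical measure. -/
def Q (ρ T : ℝ) (μ : ℝ → TDist) : EReal :=
  Qdyn ρ T μ + Qzero ρ (μ 0)

/-- The cutoff `χ_{[0, ∞)}(u) (1 - u / n)^+` of the indicator function of the half line. -/
def cutoff (n : ℕ) : ℝ → ℝ :=
  (Ici (0 : ℝ)).indicator fun u => max (1 - u / n) 0

/-- `ν₁(χ_{[0, ∞)}) - ν₀(χ_{[0, ∞)}) = a`. The two terms need not have a meaning separately, and the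
difference is the limit of the differences taken with the indicator function cut off at scale `n`. -/
def HalfLineGain (ν₁ ν₀ : TDist) (a : ℝ) : Prop :=
  ∃ f₁ f₀ : ℝ → ℝ, IsDensity ν₁ f₁ ∧ IsDensity ν₀ f₀ ∧
    Tendsto (fun n : ℕ => (∫ u, f₁ u * cutoff n u) - ∫ u, f₀ u * cutoff n u) atTop (𝓝 a)

/-- The rate function of the current. -/
def rateJ (ρ T α : ℝ) : EReal :=
  sInf {q | ∃ μ : ℝ → TDist, IsCadlag T μ ∧ HalfLineGain (μ T) (μ 0) α ∧ q = Q ρ T μ}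

/-- The rate function of the position of the tagged particle. -/
def rateI (ρ T α : ℝ) : EReal :=
  sInf {q | ∃ μ : ℝ → TDist, IsCadlag T μ ∧ HalfLineGain (μ T) (μ 0) (ρ * α) ∧ q = Q ρ T μ}

end ExclusionMDP

end

open MeasureTheory Filter Topology Set
open scoped SchwartzMap

noncomputable section

namespace ExclusionMDP

open ProbabilityTheory

/-! Write `σ = ρ(1-ρ)`, `K = √(2T/π)`, `P_t` for the heat semigroup with generator `½∂²`, `Z` for a
standard Gaussian and `H` for the Heaviside function. Both rates are values of the quadratic
`a²/(2σK)`, at `a = α` and at `a = ρα`. A duality argument bounds the infimum from below, and an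
explicit path attains it.

Lower bound. For a smooth compactly supported `g`, insert `G_s = P_{T-s} g` and `φ = P_T g - g` into
the two suprema. Since `G` solves the backward heat equation, the time integral in `l` drops out,
and the linear terms add up to `μ_T(g) - μ_0(g)`. Since `d/dt ‖P_t g‖² = -‖P_t g'‖²`, the two
quadratic terms add up to `2‖g‖² - 2⟨P_T g, g⟩`, which is `E ∫ (g(u + √T Z) - g(u))² du`
(`TestFn.energy_eq`, `TestFn.heatForm_eq`). The flow `G` is not compactly supported, so it is cut
off in space. The resulting commutator terms carry a factor tending to `0`, and they are controlled
because a càdlàg path is bounded uniformly on bounded sets of Schwartz functions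
(`TDist.uniform_bounded`, a Banach-Steinhaus argument). This gives `IsCadlag.le_Q`. For `g` equal to
`c` times a mollified cutoff of `H`, the form is at most `c²(K + o(1))`, because a unit jump
contributes `√T E|Z| = K`. Maximizing `ca - σc²K/2` over `c` yields `le_Q_of_halfLineGain`.

Upper bound. The extremal test functions are formally `l P_{T-s} H` and `l(P_T H - H)`, which points
to the path with density `σl(P_{T-s} H - P_s H)`. Its weak equation (`IsTest.linPart_optPath`)
reduces `l(μ, G)` to a pairing of `∂_u G` with the heat kernel. Completing squares bounds the
dynamical cost by `σl²/2 · √(T/π)` and the static cost by `σl²/2 · (K - √(T/π))`. The half-line gain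
is `σlK`, so `l = a/(σK)` matches the lower bound. -/

/-! ### Gaussian density and Gaussian integration by parts. -/

/-- The density of the standard Gaussian. -/
def gauss (z : ℝ) : ℝ := gaussianPDFReal 0 1 z

theorem gauss_eq (z : ℝ) : gauss z = (√(2 * Real.pi))⁻¹ * Real.exp (-(1 / 2) * z ^ 2) := by
  simp only [gauss, gaussianPDFReal, NNReal.coe_one, mul_one, sub_zero]
  rw [show -z ^ 2 / 2 = -(1 / 2) * z ^ 2 by ring]

theorem hasDerivAt_gauss (z : ℝ) : HasDerivAt gauss (-(z * gauss z)) z := by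
  have h : gauss = fun z => (√(2 * Real.pi))⁻¹ * Real.exp (-(1 / 2) * z ^ 2) := funext gauss_eq
  rw [gauss_eq z, h]
  refine ((((hasDerivAt_pow 2 z).const_mul (-(1 / 2) : ℝ)).exp).const_mul
    ((√(2 * Real.pi))⁻¹)).congr_deriv ?_
  push_cast
  ring

theorem continuous_gauss : Continuous gauss :=
  continuous_iff_continuousAt.2 fun z => (hasDerivAt_gauss z).continuousAt

theorem gauss_pos (z : ℝ) : 0 < gauss z := by
  rw [gauss_eq]; positivity

theorem gauss_neg (z : ℝ) : gauss (-z) = gauss z := by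
  rw [gauss_eq, gauss_eq]; simp

theorem integral_gaussian (f : ℝ → ℝ) :
    ∫ z, f z ∂gaussianReal 0 1 = ∫ z, gauss z * f z := by
  rw [integral_gaussianReal_eq_integral_smul one_ne_zero]
  rfl

theorem integrable_gauss : Integrable gauss := integrable_gaussianPDFReal 0 1

theorem integrable_id_mul_gauss : Integrable fun z => z * gauss z := by
  have := (integrable_mul_exp_neg_mul_sq (b := 1 / 2) (by norm_num)).const_mul
    (√(2 * Real.pi))⁻¹
  refine this.congr (ae_of_all _ fun z => ?_)
  simp only [gauss_eq]
  ring

/-- Stein's identity: `z · gauss z` is minus the derivative of `gauss`, so this is an integration by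
parts. -/
theorem integral_id_mul_gaussian {h h' : ℝ → ℝ} {B : ℝ} (hd : ∀ z, HasDerivAt h (h' z) z)
    (hc : Continuous h') (hB : ∀ z, |h z| ≤ B) (hB' : ∀ z, |h' z| ≤ B) :
    ∫ z, z * h z ∂gaussianReal 0 1 = ∫ z, h' z ∂gaussianReal 0 1 := by
  have hh : Continuous h := continuous_iff_continuousAt.2 fun z => (hd z).continuousAt
  have i1 : Integrable (h * fun z => -(z * gauss z)) :=
    integrable_id_mul_gauss.neg.bdd_mul (c := B) hh.aestronglyMeasurable (ae_of_all _ hB)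
  have i2 : Integrable (h' * gauss) :=
    integrable_gauss.bdd_mul (c := B) hc.aestronglyMeasurable (ae_of_all _ hB')
  have i3 : Integrable (h * gauss) :=
    integrable_gauss.bdd_mul (c := B) hh.aestronglyMeasurable (ae_of_all _ hB)
  have := integral_mul_deriv_eq_deriv_mul_of_integrable (u := h) (v := gauss)
    (fun z _ => hd z) (fun z _ => hasDerivAt_gauss z) i1 i2 i3
  rw [integral_gaussian, integral_gaussian]
  rw [show (∫ z, gauss z * h' z) = ∫ z, h' z * gauss z by simp only [mul_comm]]
  rw [← neg_neg (∫ z, h' z * gauss z), ← this, ← integral_neg]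
  congr 1
  ext z
  ring

/-! ### The heat semigroup on bounded functions. -/

/-- The heat semigroup; for `t ≤ 0` it is the identity. -/
def heat (t : ℝ) (g : ℝ → ℝ) (u : ℝ) : ℝ := ∫ z, g (u + √t * z) ∂gaussianReal 0 1

theorem heat_of_nonpos {t : ℝ} (ht : t ≤ 0) (g : ℝ → ℝ) : heat t g = g := by
  ext u
  simp [heat, Real.sqrt_eq_zero_of_nonpos ht]

theorem integrable_gaussian_of_bounded {g : ℝ → ℝ} {B : ℝ} (hg : Continuous g)
    (hB : ∀ x, |g x| ≤ B) : Integrable g (gaussianReal 0 1) :=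
  Integrable.of_bound hg.aestronglyMeasurable B (ae_of_all _ hB)

theorem integrable_heat {g : ℝ → ℝ} {B : ℝ} (hg : Continuous g) (hB : ∀ x, |g x| ≤ B) (t u : ℝ) :
    Integrable (fun z => g (u + √t * z)) (gaussianReal 0 1) :=
  integrable_gaussian_of_bounded (by fun_prop) fun _ => hB _

theorem abs_heat_le {g : ℝ → ℝ} {B : ℝ} (hB : ∀ x, |g x| ≤ B) (t u : ℝ) : |heat t g u| ≤ B := by
  have := norm_integral_le_of_norm_le_const (μ := gaussianReal 0 1)
    (C := B) (f := fun z => g (u + √t * z)) (ae_of_all _ fun z => hB (u + √t * z))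
  simpa [heat] using this

theorem continuous_heat {X : Type*} [TopologicalSpace X] [FirstCountableTopology X] {t u : X → ℝ}
    {F : X → ℝ → ℝ} {B : ℝ} (ht : Continuous t) (hu : Continuous u)
    (hF : Continuous fun p : X × ℝ => F p.1 p.2) (hB : ∀ x y, |F x y| ≤ B) :
    Continuous fun x => heat (t x) (F x) (u x) := by
  refine continuous_of_dominated (bound := fun _ => B) (fun x => ?_)
    (fun x => ae_of_all _ fun z => hB _ _) (integrable_const _) (ae_of_all _ fun z => ?_)
  · exact Continuous.aestronglyMeasurable (hF.comp (by fun_prop : Continuous fun z : ℝ =>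
      (x, u x + √(t x) * z)))
  · exact hF.comp (by fun_prop : Continuous fun x => (x, u x + √(t x) * z))

theorem hasDerivAt_heat_space {g g' : ℝ → ℝ} {B : ℝ} (hd : ∀ x, HasDerivAt g (g' x) x)
    (hc : Continuous g') (hB : ∀ x, |g x| ≤ B) (hB' : ∀ x, |g' x| ≤ B) (t u : ℝ) :
    HasDerivAt (heat t g) (heat t g' u) u := by
  have hg : Continuous g := continuous_iff_continuousAt.2 fun z => (hd z).continuousAt
  refine (hasDerivAt_integral_of_dominated_loc_of_deriv_le (μ := gaussianReal 0 1)
    (F := fun u z => g (u + √t * z)) (F' := fun u z => g' (u + √t * z)) (bound := fun _ => B)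
    (s := univ) univ_mem (Eventually.of_forall fun x => ?_) ?_ ?_ ?_ (integrable_const _) ?_).2
  · exact (integrable_heat hg hB t x).aestronglyMeasurable
  · exact integrable_heat hg hB t u
  · exact (integrable_heat hc hB' t u).aestronglyMeasurable
  · exact ae_of_all _ fun z x _ => hB' _
  · refine ae_of_all _ fun z x _ => ?_
    simpa using (hd (x + √t * z)).comp_add_const x (√t * z)

/-- Differentiating the heat flow of a moving function along `t = b + c s`. -/
theorem hasDerivAt_heat_moving {Γ Γs Γx Γxx : ℝ → ℝ → ℝ} {B : ℝ}
    (hs : ∀ s x, HasDerivAt (fun r => Γ r x) (Γs s x) s)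
    (hx : ∀ s x, HasDerivAt (Γ s) (Γx s x) x) (hxx : ∀ s x, HasDerivAt (Γx s) (Γxx s x) x)
    (cΓ : Continuous fun p : ℝ × ℝ => Γ p.1 p.2) (cs : Continuous fun p : ℝ × ℝ => Γs p.1 p.2)
    (cx : Continuous fun p : ℝ × ℝ => Γx p.1 p.2) (cxx : Continuous fun p : ℝ × ℝ => Γxx p.1 p.2)
    (bΓ : ∀ s x, |Γ s x| ≤ B) (bs : ∀ s x, |Γs s x| ≤ B) (bx : ∀ s x, |Γx s x| ≤ B)
    (bxx : ∀ s x, |Γxx s x| ≤ B) (b c u : ℝ) {s : ℝ} (ht : 0 < b + c * s) :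
    HasDerivAt (fun r => heat (b + c * r) (Γ r) u)
      (heat (b + c * s) (fun x => Γs s x + c / 2 * Γxx s x) u) s := by
  -- Continuity of both partial derivatives makes `Γ` jointly differentiable, so the chain rule
  -- applies along the curve `(r, u + √(b + c r) z)`.
  have chain : ∀ (r : ℝ) (z : ℝ), 0 < b + c * r → HasDerivAt (fun r => Γ r (u + √(b + c * r) * z))
      (Γs r (u + √(b + c * r) * z) +
        (c / (2 * √(b + c * r)) * z) * Γx r (u + √(b + c * r) * z)) r := by
    intro r z hr
    have h1 := hasStrictFDerivAt_uncurry_coprod (𝕜 := ℝ) (u := (r, u + √(b + c * r) * z)) (f := Γ)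
      (f₁ := fun s x => ContinuousLinearMap.toSpanSingleton ℝ (Γs s x))
      (f₂ := fun s x => ContinuousLinearMap.toSpanSingleton ℝ (Γx s x))
      (Eventually.of_forall fun v => (hs v.1 v.2).hasFDerivAt)
      (Eventually.of_forall fun v => (hx v.1 v.2).hasFDerivAt)
      (((ContinuousLinearMap.toSpanSingletonCLE (𝕜 := ℝ) (E := ℝ)).continuous.comp cs).continuousAt)
      (((ContinuousLinearMap.toSpanSingletonCLE (𝕜 := ℝ) (E := ℝ)).continuous.comp cx).continuousAt)
    have h2 : HasDerivAt (fun r => (r, u + √(b + c * r) * z))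
        (1, c / (2 * √(b + c * r)) * z) r := by
      refine (hasDerivAt_id r).prodMk ?_
      have h3 : HasDerivAt (fun r => b + c * r) c r := by
        simpa using ((hasDerivAt_id r).const_mul c).const_add b
      simpa using ((h3.sqrt hr.ne').mul_const z).const_add u
    have := h1.hasFDerivAt.comp_hasDerivAt r h2
    refine this.congr_deriv ?_
    simp [Function.HasUncurry.uncurry, ContinuousLinearMap.toSpanSingleton_apply]
  set t := b + c * s with ht'
  -- Keeping the time above `t / 2` bounds the factor `1 / √(b + c r)`, which gives an integrable
  -- majorant of order `1 + |z|`.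
  obtain ⟨S, hS, hSpos⟩ : ∃ S ∈ 𝓝 s, ∀ r ∈ S, t / 2 < b + c * r := by
    refine ⟨{r | t / 2 < b + c * r}, ?_, fun r hr => hr⟩
    exact (isOpen_lt continuous_const (by fun_prop)).mem_nhds (by change t / 2 < b + c * s; linarith)
  have hb : ∀ r ∈ S, √(t / 2) ≤ √(b + c * r) := fun r hr => Real.sqrt_le_sqrt (hSpos r hr).le
  have hq : 0 < √(t / 2) := Real.sqrt_pos.2 (by linarith)
  have B0 : 0 ≤ B := (abs_nonneg _).trans (bΓ 0 0)
  have iz : Integrable (fun z : ℝ => |z|) (gaussianReal 0 1) :=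
    ((memLp_id_gaussianReal 1).integrable (by simp)).abs
  have main := hasDerivAt_integral_of_dominated_loc_of_deriv_le (μ := gaussianReal 0 1)
    (F := fun r z => Γ r (u + √(b + c * r) * z))
    (F' := fun r z => Γs r (u + √(b + c * r) * z) +
        (c / (2 * √(b + c * r)) * z) * Γx r (u + √(b + c * r) * z))
    (bound := fun z => B + |c| / (2 * √(t / 2)) * |z| * B)
    (s := S) (x₀ := s) hS ?_ ?_ ?_ ?_ ?_ ?_
  rotate_left
  · exact Eventually.of_forall fun r => Continuous.aestronglyMeasurable
      (cΓ.comp (by fun_prop : Continuous fun z : ℝ => (r, u + √(b + c * r) * z)))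
  · exact integrable_heat (cΓ.comp (by fun_prop : Continuous fun z : ℝ => (s, z))) (bΓ s) _ u
  · have c1 := cs.comp (by fun_prop : Continuous fun z : ℝ => (s, u + √(b + c * s) * z))
    have c2 := cx.comp (by fun_prop : Continuous fun z : ℝ => (s, u + √(b + c * s) * z))
    exact Continuous.aestronglyMeasurable (c1.add ((by fun_prop : Continuous fun z : ℝ =>
      (c / (2 * √(b + c * s)) * z)).mul c2))
  · refine ae_of_all _ fun z r hr => ?_
    refine (norm_add_le _ _).trans (add_le_add (bs _ _) ?_)
    rw [norm_mul, norm_mul, norm_div]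
    have : ‖2 * √(b + c * r)‖ = 2 * √(b + c * r) := by
      rw [Real.norm_of_nonneg]; positivity
    rw [this]
    have h5 := hb r hr
    have h6 := bx r (u + √(b + c * r) * z)
    simp only [Real.norm_eq_abs]
    gcongr
  · exact (integrable_const _).add ((iz.const_mul _).mul_const _)
  · exact ae_of_all _ fun z r hr => chain r z (by have := hSpos r hr; linarith)
  have h := main.2
  have cg : ∀ {f : ℝ → ℝ → ℝ}, (Continuous fun p : ℝ × ℝ => f p.1 p.2) → Continuous (f s) :=
    fun hf => hf.comp (by fun_prop : Continuous fun z : ℝ => (s, z))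
  have i1 := integrable_heat (cg cs) (bs s) t u
  have i2 := integrable_heat (cg cxx) (bxx s) t u
  have hst : 0 < √t := Real.sqrt_pos.2 ht
  -- Stein's identity trades the factor `z` for a second space derivative and a factor `√t`. The
  -- latter cancels the singular `1 / √t`.
  have stein := integral_id_mul_gaussian (h := fun z => Γx s (u + √t * z))
    (h' := fun z => Γxx s (u + √t * z) * √t) (B := max B (B * √t))
    (fun z => by
      have h7 : HasDerivAt (fun z => u + √t * z) (√t) z := by
        simpa using ((hasDerivAt_id z).const_mul (√t)).const_add u
      exact (hxx s (u + √t * z)).comp z h7)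
    ((cg cxx).comp (by fun_prop) |>.mul continuous_const)
    (fun z => (bx _ _).trans (le_max_left _ _))
    (fun z => by
      rw [abs_mul, abs_of_pos hst]
      exact (mul_le_mul_of_nonneg_right (bxx _ _) hst.le).trans (le_max_right _ _))
  have i3 : Integrable (fun z => z * Γx s (u + √t * z)) (gaussianReal 0 1) := by
    refine Integrable.mul_bdd (c := B) ((memLp_id_gaussianReal 1).integrable (by simp))
      (integrable_heat (cg cx) (bx s) t u).aestronglyMeasurable (ae_of_all _ fun z => bx _ _)
  refine h.congr_deriv ?_
  have e1 : (∫ z, Γs s (u + √t * z) + (c / (2 * √t) * z) * Γx s (u + √t * z) ∂gaussianReal 0 1)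
      = ∫ z, Γs s (u + √t * z) ∂gaussianReal 0 1 +
        c / (2 * √t) * ∫ z, z * Γx s (u + √t * z) ∂gaussianReal 0 1 := by
    rw [← integral_const_mul, ← integral_add i1 (i3.const_mul _)]
    congr 1; ext z; ring
  rw [e1, stein, heat, integral_add i1 (i2.const_mul _), integral_const_mul, integral_mul_const]
  field_simp

/-! ### Uniform boundedness of càdlàg paths of tempered distributions. -/

/-- The one-sided limits bound the path near each time, on either side and at the time itself.
Compactness of `[0, T]` makes the bound global. -/
theorem IsCadlag.bounded {T : ℝ} {μ : ℝ → TDist} (hμ : IsCadlag T μ) (φ : 𝓢(ℝ, ℝ)) :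
    ∃ C, ∀ s ∈ Icc 0 T, |μ s φ| ≤ C := by
  have key : ∀ {l : Filter ℝ} {ν : TDist}, Tendsto μ l (𝓝 ν) → ∃ C, ∀ᶠ s in l, |μ s φ| ≤ C := by
    intro l ν h
    have h1 : Tendsto (fun s => |μ s φ|) l (𝓝 |ν φ|) :=
      ((PointwiseConvergenceCLM.tendsto_iff_forall_tendsto.1 h) φ).abs
    exact ⟨|ν φ| + 1, (h1.eventually (gt_mem_nhds (lt_add_one _))).mono fun s hs => hs.le⟩
  have loc : ∀ t ∈ Icc 0 T, ∃ C, ∀ᶠ s in 𝓝 t, s ∈ Icc 0 T → |μ s φ| ≤ C := by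
    intro t ht
    have hl : ∃ C, ∀ᶠ s in 𝓝[<] t, s ∈ Icc 0 T → |μ s φ| ≤ C := by
      rcases ht.1.eq_or_lt with h | h
      · refine ⟨0, eventually_nhdsWithin_of_forall fun s hs h' => absurd h'.1 ?_⟩
        rw [h]; exact not_le.2 hs
      · obtain ⟨ν, hν⟩ := hμ.2 t ⟨h, ht.2⟩
        obtain ⟨C, hC⟩ := key hν
        exact ⟨C, hC.mono fun s hs _ => hs⟩
    have hr : ∃ C, ∀ᶠ s in 𝓝[>] t, s ∈ Icc 0 T → |μ s φ| ≤ C := by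
      rcases ht.2.eq_or_lt with h | h
      · refine ⟨0, eventually_nhdsWithin_of_forall fun s hs h' => absurd h'.2 ?_⟩
        rw [← h]; exact not_le.2 hs
      · obtain ⟨C, hC⟩ := key (hμ.1 t ⟨ht.1, h⟩)
        exact ⟨C, hC.mono fun s hs _ => hs⟩
    obtain ⟨C₁, h₁⟩ := hl
    obtain ⟨C₂, h₂⟩ := hr
    refine ⟨max (max C₁ C₂) |μ t φ|, ?_⟩
    rw [← nhdsNE_sup_pure, ← nhdsLT_sup_nhdsGT]
    refine eventually_sup.2 ⟨eventually_sup.2 ⟨?_, ?_⟩, ?_⟩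
    · exact h₁.mono fun s hs h => (hs h).trans ((le_max_left _ _).trans (le_max_left _ _))
    · exact h₂.mono fun s hs h => (hs h).trans ((le_max_right _ _).trans (le_max_left _ _))
    · exact eventually_pure.2 fun _ => le_max_right _ _
  refine isCompact_Icc.induction_on (p := fun S => ∃ C, ∀ s ∈ S, |μ s φ| ≤ C) ?_ ?_ ?_ ?_
  · exact ⟨0, fun s hs => hs.elim⟩
  · rintro S S' h ⟨C, hC⟩
    exact ⟨C, fun s hs => hC s (h hs)⟩
  · rintro S S' ⟨C, hC⟩ ⟨C', hC'⟩
    refine ⟨max C C', fun s hs => ?_⟩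
    rcases hs with hs | hs
    · exact (hC s hs).trans (le_max_left _ _)
    · exact (hC' s hs).trans (le_max_right _ _)
  · intro t ht
    obtain ⟨C, hC⟩ := loc t ht
    exact ⟨_, mem_nhdsWithin_iff_eventually.2 (hC.mono fun s hs h => hs h), C, fun s hs => hs⟩

/-- An absolutely summable combination of a bounded family of Schwartz functions. -/
theorem exists_schwartz_series {ι : Type*} {φ : ι → 𝓢(ℝ, ℝ)} {B : ℕ → ℕ → ℝ}
    (hB : ∀ k l i, SchwartzMap.seminorm ℝ k l (φ i) ≤ B k l) {a : ι → ℝ}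
    (ha : Summable fun i => |a i|) :
    ∃ Φ : 𝓢(ℝ, ℝ), (∀ x, Φ x = ∑' i, a i * φ i x) ∧
      ∀ k l, SchwartzMap.seminorm ℝ k l Φ ≤ (∑' i, |a i|) * B k l := by
  have hsm : ∀ i, ContDiff ℝ ((⊤ : ℕ∞) : WithTop ℕ∞) fun x => a i * φ i x := fun i =>
    contDiff_const.mul ((φ i).smooth ⊤)
  have hit : ∀ (k : ℕ) i x, iteratedFDeriv ℝ k (fun x => a i * φ i x) x =
      a i • iteratedFDeriv ℝ k (φ i) x := fun k i x => by
    change iteratedFDeriv ℝ k (a i • ⇑(φ i)) x = _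
    exact iteratedFDeriv_const_smul_apply ((φ i).smooth k).contDiffAt
  have hbd : ∀ (k l : ℕ) i x,
      ‖x‖ ^ k * ‖iteratedFDeriv ℝ l (fun x => a i * φ i x) x‖ ≤ |a i| * B k l := by
    intro k l i x
    rw [hit, norm_smul, Real.norm_eq_abs (a i), mul_left_comm]
    exact mul_le_mul_of_nonneg_left ((SchwartzMap.le_seminorm ℝ k l _ x).trans (hB k l i))
      (abs_nonneg _)
  have hbd0 : ∀ (l : ℕ) i x,
      ‖iteratedFDeriv ℝ l (fun x => a i * φ i x) x‖ ≤ |a i| * B 0 l := by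
    intro l i x
    simpa using hbd 0 l i x
  have hsum : ∀ k l, Summable fun i => |a i| * B k l := fun k l => ha.mul_right _
  have hder : ∀ (l : ℕ) x, iteratedFDeriv ℝ l (fun x => ∑' i, a i * φ i x) x =
      ∑' i, iteratedFDeriv ℝ l (fun x => a i * φ i x) x := fun l x =>
    iteratedFDeriv_tsum_apply (N := ⊤) hsm (fun k _ => hsum 0 k) (fun k i x _ => hbd0 k i x)
      le_top x
  have hdec : ∀ (k l : ℕ) x, ‖x‖ ^ k * ‖iteratedFDeriv ℝ l (fun x => ∑' i, a i * φ i x) x‖ ≤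
      (∑' i, |a i|) * B k l := by
    intro k l x
    have hs : Summable fun i => ‖iteratedFDeriv ℝ l (fun x => a i * φ i x) x‖ :=
      Summable.of_nonneg_of_le (fun _ => norm_nonneg _) (fun i => hbd0 l i x) (hsum 0 l)
    rw [hder, ← tsum_mul_right]
    refine (mul_le_mul_of_nonneg_left (norm_tsum_le_tsum_norm hs) (by positivity)).trans ?_
    rw [← tsum_mul_left]
    exact (hs.mul_left _).tsum_le_tsum (fun i => hbd k l i x) (hsum k l)
  let Φ : 𝓢(ℝ, ℝ) :=
    { toFun := fun x => ∑' i, a i * φ i x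
      smooth' := contDiff_tsum (N := ⊤) hsm (fun k _ => hsum 0 k) (fun k i x _ => hbd0 k i x)
      decay' := fun k l => ⟨_, hdec k l⟩ }
  refine ⟨Φ, fun x => rfl, fun k l => SchwartzMap.seminorm_le_bound ℝ k l Φ ?_ (hdec k l)⟩
  exact le_trans (by positivity) (hdec k l 0)

/-- The remainder after a finite partial sum is again a series of the same kind, with the
coefficients restricted to the complement. Each of its seminorms is therefore at most a tail of `∑
|a i|` times a constant. -/
theorem exists_hasSum_schwartz {ι : Type*} {φ : ι → 𝓢(ℝ, ℝ)} {B : ℕ → ℕ → ℝ}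
    (hB : ∀ k l i, SchwartzMap.seminorm ℝ k l (φ i) ≤ B k l) {a : ι → ℝ}
    (ha : Summable fun i => |a i|) : ∃ Φ : 𝓢(ℝ, ℝ), HasSum (fun i => a i • φ i) Φ := by
  obtain ⟨Φ, hΦ, -⟩ := exists_schwartz_series hB ha
  refine ⟨Φ, ?_⟩
  rw [HasSum, SummationFilter.unconditional_filter]
  refine ((schwartz_withSeminorms ℝ ℝ ℝ).tendsto_nhds _ _).2 ?_
  rintro ⟨k, l⟩ ε hε
  have ht : Tendsto (fun F : Finset ι => (∑' i : { i // i ∉ F }, |a i|) * B k l) atTop (𝓝 0) := by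
    simpa using (tendsto_tsum_compl_atTop_zero fun i => |a i|).mul_const (B k l)
  filter_upwards [ht.eventually (gt_mem_nhds hε)] with F hF
  refine lt_of_le_of_lt ?_ hF
  have hind : ∀ i, |({i | i ∉ F} : Set ι).indicator a i| =
      ({i | i ∉ F} : Set ι).indicator (fun i => |a i|) i := fun i => by
    by_cases h : i ∈ F <;> simp [h]
  have ha' : Summable fun i => |({i | i ∉ F} : Set ι).indicator a i| := by
    simp only [hind]; exact ha.indicator _
  obtain ⟨Ψ, hΨ, hb⟩ := exists_schwartz_series hB ha'
  have hsub : (∑ i ∈ F, a i • φ i) - Φ = -Ψ := by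
    ext x
    have hsx : Summable fun i => a i * φ i x := by
      refine Summable.of_norm_bounded (ha.mul_right (B 0 0)) fun i => ?_
      rw [norm_mul]
      exact mul_le_mul_of_nonneg_left
        ((SchwartzMap.norm_le_seminorm ℝ (φ i) x).trans (hB 0 0 i)) (abs_nonneg _)
    have h1 := hsx.sum_add_tsum_subtype_compl F
    have h2 : ∑' i, ({i | i ∉ F} : Set ι).indicator a i * φ i x =
        ∑' i : { i // i ∉ F }, a i * φ i x := by
      have := tsum_subtype ({i | i ∉ F} : Set ι) (fun i => a i * φ i x)
      refine Eq.trans ?_ this.symm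
      congr 1; ext i
      by_cases h : i ∈ F <;> simp [h]
    simp only [sub_apply, sum_apply, smul_apply, smul_eq_mul,
      neg_apply, hΦ, hΨ, h2, ← h1]
    ring
  rw [hsub, map_neg_eq_map]
  refine (hb k l).trans (le_of_eq ?_)
  congr 1
  rw [tsum_congr hind]
  exact (tsum_subtype ({i | i ∉ F} : Set ι) fun i => |a i|).symm

/-- A pointwise bounded family of tempered distributions is bounded on bounded sets. -/
theorem TDist.uniform_bounded {κ ι : Type*} {ν : κ → TDist} {φ : ι → 𝓢(ℝ, ℝ)} {B : ℕ → ℕ → ℝ}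
    (hν : ∀ ψ, ∃ C, ∀ s, |ν s ψ| ≤ C)
    (hB : ∀ k l i, SchwartzMap.seminorm ℝ k l (φ i) ≤ B k l) :
    ∃ C, ∀ s i, |ν s (φ i)| ≤ C := by
  classical
  -- For a single `s` continuity suffices: the family `φ` is von Neumann bounded. This bound may
  -- depend on `s`; it serves to define `L s` on `ℓ¹`.
  have hone : ∀ s, ∃ C, ∀ i, |ν s (φ i)| ≤ C := by
    intro s
    have hb : Bornology.IsVonNBounded ℝ (range φ) := by
      rw [(schwartz_withSeminorms ℝ ℝ ℝ).isVonNBounded_iff_seminorm_bounded]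
      rintro ⟨k, l⟩
      refine ⟨|B k l| + 1, by positivity, ?_⟩
      rintro _ ⟨i, rfl⟩
      exact ((hB k l i).trans (le_abs_self _)).trans_lt (lt_add_one _)
    have h2 := hb.image (ν s : 𝓢(ℝ, ℝ) →L[ℝ] ℝ)
    rw [NormedSpace.isVonNBounded_iff] at h2
    obtain ⟨C, hC⟩ := h2.exists_norm_le
    exact ⟨C, fun i => hC _ ⟨φ i, ⟨i, rfl⟩, rfl⟩⟩
  choose C hC using hone
  have hsa : ∀ a : lp (fun _ : ι => ℝ) 1, Summable fun i => |a i| := fun a => by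
    have := (lp.memℓp a).summable (by norm_num)
    simpa using this
  have hna : ∀ a : lp (fun _ : ι => ℝ) 1, ‖a‖ = ∑' i, |a i| := fun a => by
    rw [lp.norm_eq_tsum_rpow (by norm_num) a]; simp
  have hsm : ∀ s (a : lp (fun _ : ι => ℝ) 1), Summable fun i => a i * ν s (φ i) := fun s a => by
    refine Summable.of_norm_bounded ((hsa a).mul_right (C s)) fun i => ?_
    rw [norm_mul]
    exact mul_le_mul_of_nonneg_left (hC s i) (abs_nonneg _)
  let L : κ → (lp (fun _ : ι => ℝ) 1 →L[ℝ] ℝ) := fun s =>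
    LinearMap.mkContinuous
      { toFun := fun a => ∑' i, a i * ν s (φ i)
        map_add' := fun a b => by
          rw [← (hsm s a).tsum_add (hsm s b)]
          simp [add_mul]
        map_smul' := fun c a => by
          simp [mul_assoc, tsum_mul_left] } (C s) (fun a => by
        rw [hna, mul_comm, ← tsum_mul_right]
        refine (norm_tsum_le_tsum_norm (hsm s a).norm).trans ?_
        refine (hsm s a).norm.tsum_le_tsum (fun i => ?_) ((hsa a).mul_right (C s))
        rw [norm_mul]
        exact mul_le_mul_of_nonneg_left (hC s i) (abs_nonneg _))
  have hL : ∀ s a, L s a = ∑' i, a i * ν s (φ i) := fun s a => rfl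
  -- `L s a` is the value of `ν s` at the Schwartz function `∑ a i • φ i`, so pointwise boundedness
  -- on Schwartz space becomes pointwise boundedness on the Banach space `ℓ¹`.
  obtain ⟨C', hC'⟩ := banach_steinhaus (g := L) fun a => by
    obtain ⟨Φ, hΦ⟩ := exists_hasSum_schwartz hB (hsa a)
    obtain ⟨D, hD⟩ := hν Φ
    refine ⟨D, fun s => ?_⟩
    have h1 := (hΦ.mapL (ν s : 𝓢(ℝ, ℝ) →L[ℝ] ℝ)).tsum_eq
    have h2 : L s a = ν s Φ := by
      rw [hL]
      refine Eq.trans ?_ h1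
      congr 1; ext i
      exact ((ν s : 𝓢(ℝ, ℝ) →L[ℝ] ℝ).map_smul (a i) (φ i)).symm
    rw [h2]
    exact hD s
  refine ⟨C', fun s i => ?_⟩
  have h3 := (L s).le_opNorm (lp.single 1 i (1 : ℝ))
  have h4 : L s (lp.single 1 i (1 : ℝ)) = ν s (φ i) := by
    rw [hL, tsum_eq_single i]
    · simp
    · intro j hj
      simp [hj]
  rw [h4, lp.norm_single (by norm_num)] at h3
  simpa using h3.trans (mul_le_mul_of_nonneg_right (hC' s) (norm_nonneg _))

/-! ### Smoothness and decay of the heat flow of test functions. -/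

theorem integrable_add_mul_abs_pow_gaussian (a b : ℝ) (k : ℕ) :
    Integrable (fun z : ℝ => (a + b * |z|) ^ k) (gaussianReal 0 1) := by
  have h0 : MemLp (fun z : ℝ => z) (k : ENNReal) (gaussianReal 0 1) := by
    exact_mod_cast (memLp_id_gaussianReal (μ := 0) (v := 1) (k : NNReal))
  have h1 : MemLp (fun z : ℝ => a + b * |z|) (k : ENNReal) (gaussianReal 0 1) :=
    (memLp_const a).add (h0.abs.const_mul b)
  have h2 := h1.integrable_norm_pow'
  have h3 : AEStronglyMeasurable (fun z : ℝ => (a + b * |z|) ^ k) (gaussianReal 0 1) := by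
    fun_prop
  refine h2.mono h3 (ae_of_all _ fun z => ?_)
  rw [norm_pow, norm_pow, norm_norm]

/-- Smooth compactly supported functions on the line. -/
structure TestFn (g : ℝ → ℝ) : Prop where
  smooth : ContDiff ℝ (⊤ : ℕ∞) g
  compact : HasCompactSupport g

namespace TestFn

variable {g χ : ℝ → ℝ}

protected theorem deriv (hg : TestFn g) : TestFn (deriv g) :=
  ⟨(contDiff_infty_iff_deriv.1 hg.smooth).2, hg.compact.deriv⟩

protected theorem iteratedDeriv (hg : TestFn g) (l : ℕ) : TestFn (iteratedDeriv l g) := by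
  induction l with
  | zero => simpa using hg
  | succ l ih => rw [iteratedDeriv_succ]; exact ih.deriv

protected theorem hasDerivAt (hg : TestFn g) (x : ℝ) : HasDerivAt g (deriv g x) x :=
  ((contDiff_infty_iff_deriv.1 hg.smooth).1 x).hasDerivAt

protected theorem continuous (hg : TestFn g) : Continuous g := hg.smooth.continuous

theorem bounded (hg : TestFn g) : ∃ B, ∀ x, |g x| ≤ B :=
  hg.compact.exists_bound_of_continuous hg.continuous

theorem bounded₂ (hg : TestFn g) (hχ : TestFn χ) : ∃ B, (∀ x, |g x| ≤ B) ∧ ∀ x, |χ x| ≤ B := by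
  obtain ⟨B, hB⟩ := hg.bounded
  obtain ⟨B', hB'⟩ := hχ.bounded
  exact ⟨max B B', fun x => (hB x).trans (le_max_left _ _),
    fun x => (hB' x).trans (le_max_right _ _)⟩

protected theorem integrable (hg : TestFn g) : Integrable g :=
  hg.continuous.integrable_of_hasCompactSupport hg.compact

theorem hasDerivAt_heat (hg : TestFn g) (t u : ℝ) :
    HasDerivAt (heat t g) (heat t (deriv g) u) u := by
  obtain ⟨B, h1, h2⟩ := hg.bounded₂ hg.deriv
  exact hasDerivAt_heat_space hg.hasDerivAt hg.deriv.continuous h1 h2 t u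

theorem deriv_heat (hg : TestFn g) (t : ℝ) : deriv (heat t g) = heat t (deriv g) :=
  funext fun u => (hg.hasDerivAt_heat t u).deriv

theorem iteratedDeriv_heat (t : ℝ) (l : ℕ) : ∀ {g : ℝ → ℝ}, TestFn g →
    iteratedDeriv l (heat t g) = heat t (iteratedDeriv l g) := by
  induction l with
  | zero => intro g _; simp
  | succ l ih =>
    intro g hg
    rw [iteratedDeriv_succ', hg.deriv_heat, ih hg.deriv, iteratedDeriv_succ']

theorem contDiff_heat (hg : TestFn g) (t : ℝ) : ContDiff ℝ (⊤ : ℕ∞) (heat t g) := by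
  rw [contDiff_infty]
  intro n
  induction n generalizing g with
  | zero =>
    exact contDiff_zero.2 (continuous_iff_continuousAt.2 fun u => (hg.hasDerivAt_heat t u).continuousAt)
  | succ n ih =>
    push_cast
    rw [contDiff_succ_iff_deriv]
    refine ⟨fun u => (hg.hasDerivAt_heat t u).differentiableAt, by simp, ?_⟩
    rw [hg.deriv_heat]
    exact ih hg.deriv

theorem continuous_heat_uncurry (hg : TestFn g) : Continuous fun p : ℝ × ℝ => heat p.1 g p.2 := by
  obtain ⟨B, hB⟩ := hg.bounded
  exact continuous_heat (F := fun _ => g) continuous_fst continuous_snd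
    (hg.continuous.comp continuous_snd) fun _ => hB

theorem hasDerivAt_heat_time (hg : TestFn g) {t : ℝ} (ht : 0 < t) (u : ℝ) :
    HasDerivAt (fun r => heat r g u) (1 / 2 * heat t (deriv (deriv g)) u) t := by
  obtain ⟨B, h1, h2⟩ := hg.bounded₂ hg.deriv
  obtain ⟨B', h3, h4⟩ := hg.deriv.deriv.bounded₂ hg.deriv.deriv
  have := hasDerivAt_heat_moving (Γ := fun _ => g) (Γs := fun _ _ => 0) (Γx := fun _ => deriv g)
    (Γxx := fun _ => deriv (deriv g)) (B := max B B') (fun s x => hasDerivAt_const _ _)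
    (fun s => hg.hasDerivAt) (fun s => hg.deriv.hasDerivAt) (hg.continuous.comp continuous_snd)
    continuous_const (hg.deriv.continuous.comp continuous_snd)
    (hg.deriv.deriv.continuous.comp continuous_snd) (fun _ x => (h1 x).trans (le_max_left _ _))
    (fun _ x => by simpa using Or.inl ((abs_nonneg _).trans (h1 0)))
    (fun _ x => (h2 x).trans (le_max_left _ _))
    (fun _ x => (h3 x).trans (le_max_right _ _)) 0 1 u (s := t) (by simpa using ht)
  simp only [zero_add, one_mul] at this
  refine this.congr_deriv ?_
  rw [heat, heat, integral_const_mul]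

/-- Where the integrand is nonzero, `u + √t z` lies in the support of `g`, so `|u|` is at most a
constant plus `√T |z|`. The Gaussian moments then absorb `|u| ^ k`, uniformly in `t ≤ T`. -/
theorem heat_decay (hg : TestFn g) (T : ℝ) (k : ℕ) :
    ∃ C, ∀ t ≤ T, ∀ u, |u| ^ k * |heat t g u| ≤ C := by
  obtain ⟨B, hB⟩ := hg.bounded
  obtain ⟨M, hM⟩ := hg.compact.isCompact.isBounded.exists_norm_le
  have B0 : 0 ≤ B := (abs_nonneg _).trans (hB 0)
  have hint : Integrable (fun z => (|M| + √T * |z|) ^ k * B) (gaussianReal 0 1) :=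
    (integrable_add_mul_abs_pow_gaussian _ _ k).mul_const B
  refine ⟨∫ z, (|M| + √T * |z|) ^ k * B ∂gaussianReal 0 1, fun t ht u => ?_⟩
  rw [← abs_of_nonneg (pow_nonneg (abs_nonneg u) k), ← abs_mul, heat, ← integral_const_mul]
  change ‖∫ z, |u| ^ k * g (u + √t * z) ∂gaussianReal 0 1‖ ≤ _
  refine norm_integral_le_of_norm_le hint (ae_of_all _ fun z => ?_)
  rw [Real.norm_eq_abs, abs_mul, abs_of_nonneg (pow_nonneg (abs_nonneg u) k)]
  by_cases h0 : g (u + √t * z) = 0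
  · rw [h0]; simp only [abs_zero, mul_zero]; positivity
  · have h3 : |u + √t * z| ≤ M := hM _ (subset_tsupport _ h0)
    have h4 : |u| ≤ |M| + √T * |z| := by
      have h5 : |u| ≤ |u + √t * z| + |√t * z| := by
        simpa using abs_sub (u + √t * z) (√t * z)
      have h6 : |√t * z| ≤ √T * |z| := by
        rw [abs_mul, abs_of_nonneg (Real.sqrt_nonneg _)]
        gcongr
      linarith [le_abs_self M]
    gcongr
    exact hB _

theorem heat_le_inv_one_add_sq (hg : TestFn g) (T : ℝ) :
    ∃ C, 0 ≤ C ∧ ∀ t ≤ T, ∀ u, |heat t g u| ≤ C * (1 + u ^ 2)⁻¹ := by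
  obtain ⟨C, hC⟩ := hg.heat_decay T 0
  obtain ⟨C', hC'⟩ := hg.heat_decay T 2
  have h0 : ∀ t ≤ T, ∀ u, |heat t g u| ≤ (C + C') * (1 + u ^ 2)⁻¹ := by
    intro t ht u
    rw [← div_eq_mul_inv, le_div_iff₀ (by positivity)]
    have h1 := hC t ht u
    have h2 := hC' t ht u
    rw [sq_abs] at h2
    simp only [pow_zero, one_mul] at h1
    linarith
  refine ⟨C + C', ?_, h0⟩
  have := (abs_nonneg _).trans (h0 T le_rfl 0)
  simpa using this

end TestFn

/-! ### Energy identity for the heat semigroup. -/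

namespace TestFn

variable {g : ℝ → ℝ}

theorem integrable_heat_mul {h : ℝ → ℝ} (hg : TestFn g) (hh : TestFn h) (t r : ℝ) :
    Integrable fun u => heat t g u * heat r h u := by
  obtain ⟨C, C0, hC⟩ := hg.heat_le_inv_one_add_sq t
  obtain ⟨B, hB⟩ := hh.bounded
  refine Integrable.mono' (integrable_inv_one_add_sq.const_mul (C * B))
    (Continuous.aestronglyMeasurable ((hg.contDiff_heat t).continuous.mul
      (hh.contDiff_heat r).continuous)) (ae_of_all _ fun u => ?_)
  rw [norm_mul]
  calc ‖heat t g u‖ * ‖heat r h u‖ ≤ (C * (1 + u ^ 2)⁻¹) * B :=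
        mul_le_mul (hC t le_rfl u) (abs_heat_le hB r u) (norm_nonneg _) (by positivity)
    _ = _ := by ring

theorem continuous_integral_heat_sq (hg : TestFn g) (T : ℝ) :
    ContinuousOn (fun t => ∫ u, heat t g u ^ 2) (Iic T) := by
  obtain ⟨C, C0, hC⟩ := hg.heat_le_inv_one_add_sq T
  obtain ⟨B, hB⟩ := hg.bounded
  refine continuousOn_of_dominated (bound := fun u => C * (1 + u ^ 2)⁻¹ * B) (fun t _ => ?_)
    (fun t ht => ae_of_all _ fun u => ?_) ?_ (ae_of_all _ fun u => ?_)
  · exact ((hg.contDiff_heat t).continuous.pow 2).aestronglyMeasurable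
  · rw [norm_pow, sq]
    exact mul_le_mul (hC t ht u) (abs_heat_le hB t u) (norm_nonneg _) (by positivity)
  · exact (integrable_inv_one_add_sq.const_mul C).mul_const B
  · exact ((hg.continuous_heat_uncurry.comp (by fun_prop : Continuous fun t : ℝ => (t, u))).pow
      2).continuousOn

theorem integral_heat_mul_deriv_deriv (hg : TestFn g) (t : ℝ) :
    ∫ u, heat t g u * heat t (deriv (deriv g)) u = -∫ u, heat t (deriv g) u ^ 2 := by
  rw [integral_mul_deriv_eq_deriv_mul_of_integrable (u := heat t g) (v := heat t (deriv g))
    (u' := heat t (deriv g)) (fun x _ => hg.hasDerivAt_heat t x)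
    (fun x _ => hg.deriv.hasDerivAt_heat t x) (hg.integrable_heat_mul hg.deriv.deriv t t)
    (hg.deriv.integrable_heat_mul hg.deriv t t) (hg.integrable_heat_mul hg.deriv t t)]
  simp only [sq]

/-- Energy dissipation: differentiating under the integral gives `⟨P_t g, P_t g''⟩`, and an
integration by parts in space turns it into `-‖P_t g'‖²`. -/
theorem hasDerivAt_integral_heat_sq (hg : TestFn g) {t : ℝ} (ht : 0 < t) :
    HasDerivAt (fun r => ∫ u, heat r g u ^ 2) (-∫ u, heat t (deriv g) u ^ 2) t := by
  obtain ⟨C, C0, hC⟩ := hg.heat_le_inv_one_add_sq (t + 1)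
  obtain ⟨B, hB⟩ := hg.deriv.deriv.bounded
  have := (hasDerivAt_integral_of_dominated_loc_of_deriv_le (μ := volume)
    (F := fun r u => heat r g u ^ 2) (x₀ := t)
    (F' := fun r u => heat r g u * heat r (deriv (deriv g)) u)
    (bound := fun u => C * (1 + u ^ 2)⁻¹ * B) (s := Ioo 0 (t + 1))
    (Ioo_mem_nhds ht (lt_add_one t)) ?_ ?_ ?_ ?_ ?_ ?_).2
  · rwa [hg.integral_heat_mul_deriv_deriv] at this
  · exact Eventually.of_forall fun r =>
      ((hg.contDiff_heat r).continuous.pow 2).aestronglyMeasurable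
  · simpa only [sq] using hg.integrable_heat_mul hg t t
  · exact (hg.integrable_heat_mul hg.deriv.deriv t t).aestronglyMeasurable
  · refine ae_of_all _ fun u r hr => ?_
    rw [norm_mul]
    exact mul_le_mul (hC r hr.2.le u) (abs_heat_le hB r u) (norm_nonneg _) (by positivity)
  · exact (integrable_inv_one_add_sq.const_mul C).mul_const B
  · refine ae_of_all _ fun u r hr => ?_
    refine ((hg.hasDerivAt_heat_time hr.1 u).pow 2).congr_deriv ?_
    push_cast
    ring

theorem integral_heat_deriv_sq (hg : TestFn g) {T : ℝ} (hT : 0 ≤ T) :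
    ∫ s in (0 : ℝ)..T, ∫ u, heat (T - s) (deriv g) u ^ 2 =
      (∫ u, g u ^ 2) - ∫ u, heat T g u ^ 2 := by
  rw [intervalIntegral.integral_comp_sub_left (fun t => ∫ u, heat t (deriv g) u ^ 2), sub_self,
    sub_zero]
  have h1 := intervalIntegral.integral_eq_sub_of_hasDerivAt_of_le (a := 0) (b := T) hT
    (f := fun r => ∫ u, heat r g u ^ 2) (f' := fun t => -∫ u, heat t (deriv g) u ^ 2)
    ((hg.continuous_integral_heat_sq T).mono fun x hx => hx.2)
    (fun t ht => hg.hasDerivAt_integral_heat_sq ht.1)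
    (((hg.deriv.continuous_integral_heat_sq T).mono fun x hx => by
      rw [uIcc_of_le hT] at hx; exact hx.2).intervalIntegrable.neg)
  rw [intervalIntegral.integral_neg, heat_of_nonpos le_rfl] at h1
  linarith

end TestFn

/-- The Dirichlet form `∬ p_T(y) (g(u + y) - g(u))² dy du` of the heat semigroup. -/
def heatForm (T : ℝ) (g : ℝ → ℝ) : ℝ := 2 * (∫ u, g u ^ 2) - 2 * ∫ u, heat T g u * g u

/-- The dynamical energy is `‖g‖² - ‖P_T g‖²`. Expanding the static square produces `+‖P_T g‖²`,
which cancels. -/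
theorem TestFn.energy_eq {g : ℝ → ℝ} (hg : TestFn g) {T : ℝ} (hT : 0 ≤ T) :
    (∫ s in (0 : ℝ)..T, ∫ u, heat (T - s) (deriv g) u ^ 2) + ∫ u, (heat T g u - g u) ^ 2 =
      heatForm T g := by
  have i1 := hg.integrable_heat_mul hg T T
  have i2 := hg.integrable_heat_mul hg T 0
  have i3 := hg.integrable_heat_mul hg 0 0
  rw [heat_of_nonpos le_rfl] at i2 i3
  have : ∫ u, (heat T g u - g u) ^ 2 =
      (∫ u, heat T g u ^ 2) - 2 * (∫ u, heat T g u * g u) + ∫ u, g u ^ 2 := by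
    simp only [sq]
    rw [← integral_const_mul, ← integral_sub i1 (i2.const_mul 2), ← integral_add _ i3]
    · congr 1; ext u; ring
    · exact i1.sub (i2.const_mul 2)
  rw [hg.integral_heat_deriv_sq hT, this, heatForm]
  ring

/-! ### Spatial truncation and uniform Schwartz bounds. -/

/-- A smooth cutoff, equal to `1` on `[-1, 1]` and supported in `[-2, 2]`. -/
def cut : ℝ → ℝ := (⟨1, 2, one_pos, one_lt_two⟩ : ContDiffBump (0 : ℝ))

theorem testFn_cut : TestFn cut :=
  ⟨ContDiffBump.contDiff _, ContDiffBump.hasCompactSupport _⟩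

theorem cut_eq_one {u : ℝ} (hu : |u| ≤ 1) : cut u = 1 :=
  ContDiffBump.one_of_mem_closedBall _ (by simpa using hu)

theorem cut_nonneg (u : ℝ) : 0 ≤ cut u := ContDiffBump.nonneg _

theorem cut_le_one (u : ℝ) : cut u ≤ 1 := ContDiffBump.le_one _

theorem deriv_cut_eq_zero {u : ℝ} (hu : |u| < 1) : deriv cut u = 0 := by
  have : cut =ᶠ[𝓝 u] fun _ => 1 := by
    filter_upwards [(isOpen_lt continuous_abs continuous_const).mem_nhds hu] with v hv
    exact cut_eq_one (le_of_lt hv)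
  rw [this.deriv_eq, deriv_const]

/-- A smooth compactly supported function as a Schwartz function. -/
def TestFn.toSchwartz {g : ℝ → ℝ} (hg : TestFn g) : 𝓢(ℝ, ℝ) := hg.compact.toSchwartzMap hg.smooth

@[simp] theorem TestFn.coe_toSchwartz {g : ℝ → ℝ} (hg : TestFn g) : ⇑hg.toSchwartz = g := rfl

theorem pairing_schwartz (ν : TDist) (φ : 𝓢(ℝ, ℝ)) : pairing ν φ = ν φ := by
  have h : ∃ ψ : 𝓢(ℝ, ℝ), ⇑ψ = ⇑φ := ⟨φ, rfl⟩
  rw [pairing, dif_pos h, DFunLike.coe_injective h.choose_spec]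

/-- The inverse of the truncation radius. -/
def invScale (n : ℕ) : ℝ := ((n : ℝ) + 1)⁻¹

theorem invScale_pos (n : ℕ) : 0 < invScale n := by unfold invScale; positivity

theorem invScale_le_one (n : ℕ) : invScale n ≤ 1 :=
  inv_le_one_of_one_le₀ (by linarith [n.cast_nonneg (α := ℝ)])

theorem tendsto_invScale : Tendsto invScale atTop (𝓝 0) := by
  have := tendsto_one_div_add_atTop_nhds_zero_nat (𝕜 := ℝ)
  simp only [one_div] at this
  exact this

namespace TestFn

variable {g χ : ℝ → ℝ}

theorem comp_const_mul (hχ : TestFn χ) {ε : ℝ} (hε : ε ≠ 0) : TestFn fun u => χ (ε * u) := by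
  refine ⟨hχ.smooth.comp (contDiff_const.mul contDiff_id), ?_⟩
  exact hχ.compact.comp_homeomorph (Homeomorph.mulLeft₀ ε hε)

theorem cutHeat (hχ : TestFn χ) (hg : TestFn g) (t : ℝ) (n : ℕ) :
    TestFn fun u => χ (invScale n * u) * heat t g u := by
  have h := hχ.comp_const_mul (invScale_pos n).ne'
  exact ⟨h.smooth.mul (hg.contDiff_heat t), h.compact.mul_right⟩

/-- By the Leibniz rule: derivatives of the rescaled cutoff only gain powers of `invScale n ≤ 1`,
and the polynomial weight is absorbed by `heat_decay`. The point is uniformity in both `t` and `n`.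
-/
theorem seminorm_cutHeat_le (hχ : TestFn χ) (hg : TestFn g) (T : ℝ) :
    ∃ B : ℕ → ℕ → ℝ, ∀ k l t n, t ≤ T →
      SchwartzMap.seminorm ℝ k l (hχ.cutHeat hg t n).toSchwartz ≤ B k l := by
  choose A hA using fun i => (hχ.iteratedDeriv i).bounded
  choose C hC using fun k i => (hg.iteratedDeriv i).heat_decay T k
  have key : ∀ (k l : ℕ) t n, t ≤ T → ∀ u, ‖u‖ ^ k *
      ‖iteratedFDeriv ℝ l (fun u => χ (invScale n * u) * heat t g u) u‖ ≤
      ∑ i ∈ Finset.range (l + 1), (l.choose i : ℝ) * A i * C k (l - i) := by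
    intro k l t n ht u
    have h1 := norm_iteratedFDeriv_mul_le (n := l)
      (hχ.comp_const_mul (invScale_pos n).ne').smooth (hg.contDiff_heat t) u
      (by exact_mod_cast le_top)
    refine (mul_le_mul_of_nonneg_left h1 (by positivity)).trans ?_
    rw [Finset.mul_sum]
    refine Finset.sum_le_sum fun i _ => ?_
    rw [norm_iteratedFDeriv_eq_norm_iteratedDeriv, norm_iteratedFDeriv_eq_norm_iteratedDeriv,
      iteratedDeriv_comp_const_mul (hχ.smooth.of_le (by exact_mod_cast le_top)),
      TestFn.iteratedDeriv_heat t _ hg]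
    have h2 : ‖invScale n ^ i * iteratedDeriv i χ (invScale n * u)‖ ≤ A i := by
      rw [norm_mul, norm_pow, Real.norm_of_nonneg (invScale_pos n).le]
      calc _ ≤ 1 * A i := mul_le_mul (pow_le_one₀ (invScale_pos n).le (invScale_le_one n))
            (hA i _) (abs_nonneg _) zero_le_one
        _ = _ := one_mul _
    calc _ = (l.choose i : ℝ) * ‖invScale n ^ i * iteratedDeriv i χ (invScale n * u)‖ *
          (|u| ^ k * |heat t (iteratedDeriv (l - i) g) u|) := by
            simp only [Real.norm_eq_abs]; ring
      _ ≤ _ := mul_le_mul (mul_le_mul_of_nonneg_left h2 (by positivity)) (hC k (l - i) t ht u)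
            (by positivity) (mul_nonneg (by positivity) ((norm_nonneg _).trans h2))
  refine ⟨fun k l => ∑ i ∈ Finset.range (l + 1), (l.choose i : ℝ) * A i * C k (l - i),
    fun k l t n ht => SchwartzMap.seminorm_le_bound ℝ k l _ ?_ (key k l t n ht)⟩
  exact le_trans (by positivity) (key k l t n ht 0)

end TestFn

/-- The truncation errors in the linear part are such pairings multiplied by positive powers of
`invScale n`, so this bound makes them vanish in the limit. -/
theorem IsCadlag.bounded_cutHeat {T : ℝ} {μ : ℝ → TDist} (hμ : IsCadlag T μ) {χ g : ℝ → ℝ}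
    (hχ : TestFn χ) (hg : TestFn g) :
    ∃ C, ∀ s ∈ Icc 0 T, ∀ t ≤ T, ∀ n, |μ s (hχ.cutHeat hg t n).toSchwartz| ≤ C := by
  obtain ⟨B, hB⟩ := hχ.seminorm_cutHeat_le hg T
  obtain ⟨C, hC⟩ := TDist.uniform_bounded (κ := Icc 0 T) (ι := Iic T × ℕ)
    (ν := fun s => μ s) (φ := fun i => (hχ.cutHeat hg i.1 i.2).toSchwartz) (B := B)
    (fun ψ => by
      obtain ⟨C, hC⟩ := hμ.bounded ψ
      exact ⟨C, fun s => hC s s.2⟩)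
    (fun k l i => hB k l i.1 i.2 i.1.2)
  exact ⟨C, fun s hs t ht n => hC ⟨s, hs⟩ (⟨t, ht⟩, n)⟩

theorem IsTest.of_hasDerivAt {G Gs Gu Guu : ℝ → ℝ → ℝ}
    (hc : HasCompactSupport fun p : ℝ × ℝ => G p.1 p.2)
    (hs : ∀ s u, HasDerivAt (fun r => G r u) (Gs s u) s)
    (hu : ∀ s u, HasDerivAt (G s) (Gu s u) u) (huu : ∀ s u, HasDerivAt (Gu s) (Guu s u) u)
    (cG : Continuous fun p : ℝ × ℝ => G p.1 p.2) (cs : Continuous fun p : ℝ × ℝ => Gs p.1 p.2)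
    (cu : Continuous fun p : ℝ × ℝ => Gu p.1 p.2)
    (cuu : Continuous fun p : ℝ × ℝ => Guu p.1 p.2) :
    IsTest G ∧ (∀ s, deriv (G s) = Gu s) ∧ ∀ s, iteratedDeriv 2 (G s) = Guu s := by
  have e1 : ∀ s, deriv (G s) = Gu s := fun s => funext fun u => (hu s u).deriv
  have e2 : ∀ s, iteratedDeriv 2 (G s) = Guu s := fun s => by
    rw [iteratedDeriv_succ, iteratedDeriv_one, e1]
    exact funext fun u => (huu s u).deriv
  refine ⟨⟨hc, cG, fun u s => (hs s u).differentiableAt, ?_, fun s => ?_, ?_, ?_⟩, e1, e2⟩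
  · simpa only [(hs _ _).deriv] using cs
  · rw [show (2 : WithTop ℕ∞) = 1 + 1 by norm_num, contDiff_succ_iff_deriv]
    refine ⟨fun u => (hu s u).differentiableAt, by simp, ?_⟩
    rw [e1, contDiff_one_iff_deriv]
    refine ⟨fun u => (huu s u).differentiableAt, ?_⟩
    rw [show deriv (Gu s) = Guu s from funext fun u => (huu s u).deriv]
    exact cuu.comp (by fun_prop : Continuous fun u : ℝ => (s, u))
  · simpa only [e1] using cu
  · simpa only [e2] using cuu

/-! ### The truncated backward heat flow as a test function. -/

/-- A continuously differentiable extension of the heat flow to negative times. -/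
def heatExt (g : ℝ → ℝ) (t u : ℝ) : ℝ := heat t g u + min t 0 / 2 * deriv (deriv g) u

theorem heatExt_of_nonneg (g : ℝ → ℝ) {t : ℝ} (ht : 0 ≤ t) (u : ℝ) :
    heatExt g t u = heat t g u := by
  simp [heatExt, min_eq_right ht]

namespace TestFn

variable {g : ℝ → ℝ}

theorem continuous_heatExt (hg : TestFn g) :
    Continuous fun p : ℝ × ℝ => heatExt g p.1 p.2 := by
  have h1 := hg.continuous_heat_uncurry
  have h2 := hg.deriv.deriv.continuous
  unfold heatExt
  fun_prop

theorem hasDerivAt_heatExt_space (hg : TestFn g) (t u : ℝ) :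
    HasDerivAt (heatExt g t) (heatExt (deriv g) t u) u :=
  (hg.hasDerivAt_heat t u).add ((hg.deriv.deriv.hasDerivAt u).const_mul _)

/-- For `t < 0` the extension is affine in `t` with slope `½ g''`, and `heat t` is the identity
there, so one formula serves both signs. At `t = 0` the derivative is obtained as the limit of the
derivatives at nearby times. -/
theorem hasDerivAt_heatExt_time (hg : TestFn g) (t u : ℝ) :
    HasDerivAt (fun r => heatExt g r u) (1 / 2 * heat t (deriv (deriv g)) u) t := by
  refine hasDerivAt_of_hasDerivAt_of_ne' (x := 0)
    (g := fun t => 1 / 2 * heat t (deriv (deriv g)) u) (fun y hy => ?_) ?_ ?_ t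
  · rcases lt_or_gt_of_ne hy with h | h
    · have e : (fun r => heatExt g r u) =ᶠ[𝓝 y] fun r => g u + r / 2 * deriv (deriv g) u := by
        filter_upwards [Iio_mem_nhds h] with r hr
        rw [heatExt, heat_of_nonpos (le_of_lt hr), min_eq_left (le_of_lt hr)]
      refine HasDerivAt.congr_of_eventuallyEq ?_ e
      rw [heat_of_nonpos h.le]
      exact (((hasDerivAt_id y).div_const 2).mul_const _).const_add _
    · refine (hg.hasDerivAt_heat_time h u).congr_of_eventuallyEq ?_
      filter_upwards [Ioi_mem_nhds h] with r hr
      exact heatExt_of_nonneg g (le_of_lt hr) u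
  · exact (hg.continuous_heatExt.comp
      (by fun_prop : Continuous fun r : ℝ => (r, u))).continuousAt
  · exact (continuous_const.mul (hg.deriv.deriv.continuous_heat_uncurry.comp
      (by fun_prop : Continuous fun r : ℝ => (r, u)))).continuousAt

end TestFn

/-- The backward heat flow with terminal value `g` at time `T`, truncated in space and time. -/
def truncHeat (T : ℝ) (n : ℕ) (g : ℝ → ℝ) (s u : ℝ) : ℝ :=
  cut ((T + 1)⁻¹ * s) * (cut (invScale n * u) * heatExt g (T - s) u)

theorem TestFn.isTest_truncHeat {g : ℝ → ℝ} (hg : TestFn g) {T : ℝ} (hT : 0 ≤ T) (n : ℕ) :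
    IsTest (truncHeat T n g) ∧
    (∀ s u, deriv (fun r => truncHeat T n g r u) s =
      (T + 1)⁻¹ * deriv cut ((T + 1)⁻¹ * s) * (cut (invScale n * u) * heatExt g (T - s) u) +
      cut ((T + 1)⁻¹ * s) *
        (cut (invScale n * u) * -(1 / 2 * heat (T - s) (deriv (deriv g)) u))) ∧
    (∀ s, deriv (truncHeat T n g s) = fun u => cut ((T + 1)⁻¹ * s) *
      (invScale n * deriv cut (invScale n * u) * heatExt g (T - s) u +
        cut (invScale n * u) * heatExt (deriv g) (T - s) u)) ∧
    ∀ s, iteratedDeriv 2 (truncHeat T n g s) = fun u => cut ((T + 1)⁻¹ * s) *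
      (invScale n ^ 2 * deriv (deriv cut) (invScale n * u) * heatExt g (T - s) u +
        2 * invScale n * deriv cut (invScale n * u) * heatExt (deriv g) (T - s) u +
        cut (invScale n * u) * heatExt (deriv (deriv g)) (T - s) u) := by
  have hsc : ∀ {χ : ℝ → ℝ}, TestFn χ → ∀ c u : ℝ,
      HasDerivAt (fun u => χ (c * u)) (c * deriv χ (c * u)) u := fun hχ c u => by
    have h1 : HasDerivAt (fun u => c * u) c u := by simpa using (hasDerivAt_id u).const_mul c
    exact ((hχ.hasDerivAt (c * u)).comp u h1).congr_deriv (mul_comm _ _)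
  have hs : ∀ s u, HasDerivAt (fun r => truncHeat T n g r u) ((T + 1)⁻¹ * deriv cut ((T + 1)⁻¹ * s)
      * (cut (invScale n * u) * heatExt g (T - s) u) + cut ((T + 1)⁻¹ * s) *
        (cut (invScale n * u) * -(1 / 2 * heat (T - s) (deriv (deriv g)) u))) s := by
    intro s u
    have h2 : HasDerivAt (fun s => T - s) (-1) s := by
      simpa using (hasDerivAt_id s).const_sub T
    have h3 := (hg.hasDerivAt_heatExt_time (T - s) u).comp s h2
    refine ((hsc testFn_cut (T + 1)⁻¹ s).mul (h3.const_mul (cut (invScale n * u)))).congr_deriv ?_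
    simp only [Function.comp]
    ring
  have hu : ∀ s u, HasDerivAt (truncHeat T n g s) (cut ((T + 1)⁻¹ * s) *
      (invScale n * deriv cut (invScale n * u) * heatExt g (T - s) u +
        cut (invScale n * u) * heatExt (deriv g) (T - s) u)) u := fun s u =>
    ((hsc testFn_cut (invScale n) u).mul (hg.hasDerivAt_heatExt_space (T - s) u)).const_mul _
  have huu : ∀ s u, HasDerivAt (fun u => cut ((T + 1)⁻¹ * s) *
      (invScale n * deriv cut (invScale n * u) * heatExt g (T - s) u +
        cut (invScale n * u) * heatExt (deriv g) (T - s) u)) (cut ((T + 1)⁻¹ * s) *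
      (invScale n ^ 2 * deriv (deriv cut) (invScale n * u) * heatExt g (T - s) u +
        2 * invScale n * deriv cut (invScale n * u) * heatExt (deriv g) (T - s) u +
        cut (invScale n * u) * heatExt (deriv (deriv g)) (T - s) u)) u := by
    intro s u
    have h1 := (((hsc testFn_cut.deriv (invScale n) u).const_mul (invScale n)).mul
      (hg.hasDerivAt_heatExt_space (T - s) u)).add
      ((hsc testFn_cut (invScale n) u).mul (hg.deriv.hasDerivAt_heatExt_space (T - s) u))
    refine (h1.const_mul (cut ((T + 1)⁻¹ * s))).congr_deriv ?_
    ring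
  have k0 := testFn_cut.continuous
  have k1 := testFn_cut.deriv.continuous
  have k2 := testFn_cut.deriv.deriv.continuous
  have cT : Continuous fun p : ℝ × ℝ => (T - p.1, p.2) := by fun_prop
  have w0 := hg.continuous_heatExt.comp cT
  have w1 := hg.deriv.continuous_heatExt.comp cT
  have w2 := hg.deriv.deriv.continuous_heatExt.comp cT
  have w3 := hg.deriv.deriv.continuous_heat_uncurry.comp cT
  simp only [Function.comp_def] at w0 w1 w2 w3
  have hcs : HasCompactSupport fun p : ℝ × ℝ => truncHeat T n g p.1 p.2 := by
    have h1 := (testFn_cut.comp_const_mul (ε := (T + 1)⁻¹) (by positivity)).compact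
    have h2 := (testFn_cut.comp_const_mul (invScale_pos n).ne').compact
    refine HasCompactSupport.intro (h1.isCompact.prod h2.isCompact) fun p hp => ?_
    rw [mem_prod, not_and_or] at hp
    rcases hp with hp | hp
    · simp [truncHeat, image_eq_zero_of_notMem_tsupport hp]
    · simp [truncHeat, image_eq_zero_of_notMem_tsupport hp]
  obtain ⟨h1, h2, h3⟩ := IsTest.of_hasDerivAt hcs hs hu huu (by unfold truncHeat; fun_prop)
    (by fun_prop) (by fun_prop) (by fun_prop)
  exact ⟨h1, fun s u => (hs s u).deriv, h2, h3⟩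

namespace TestFn

variable {g : ℝ → ℝ}

theorem eventually_cut_mul_eq (hg : TestFn g) :
    ∀ᶠ n in atTop, ∀ u, cut (invScale n * u) * g u = g u := by
  obtain ⟨M, hM⟩ := hg.compact.isCompact.isBounded.exists_norm_le
  have h : Tendsto (fun n => invScale n * M) atTop (𝓝 0) := by
    simpa using tendsto_invScale.mul_const M
  filter_upwards [h.eventually (gt_mem_nhds one_pos)] with n hn u
  by_cases h0 : g u = 0
  · simp [h0]
  · have h1 : |u| ≤ M := hM _ (subset_tsupport _ h0)
    rw [cut_eq_one, one_mul]
    rw [abs_mul, abs_of_pos (invScale_pos n)]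
    exact (mul_le_mul_of_nonneg_left h1 (invScale_pos n).le).trans hn.le

/-- A derivative falling on the spatial cutoff brings a factor `invScale n`. What it multiplies is
dominated by the integrable function `(1 + u²)⁻¹`. -/
theorem energy_truncHeat_le (hg : TestFn g) {T : ℝ} (hT : 0 ≤ T) :
    ∃ C, ∀ n, ∫ s in (0 : ℝ)..T, ∫ u, deriv (truncHeat T n g s) u ^ 2 ≤
      (∫ s in (0 : ℝ)..T, ∫ u, heat (T - s) (deriv g) u ^ 2) + invScale n * C := by
  obtain ⟨C₀, hC₀, h₀⟩ := hg.heat_le_inv_one_add_sq T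
  obtain ⟨C₁, hC₁, h₁⟩ := hg.deriv.heat_le_inv_one_add_sq T
  obtain ⟨B, hB⟩ := hg.bounded
  obtain ⟨D, hD⟩ := testFn_cut.deriv.bounded
  have hB0 : 0 ≤ B := (abs_nonneg _).trans (hB 0)
  have hD0 : 0 ≤ D := (abs_nonneg _).trans (hD 0)
  set K := 2 * D * B * C₁ + D ^ 2 * B * C₀ with hK
  have hpt : ∀ n, ∀ s ∈ Icc 0 T, ∀ u, deriv (truncHeat T n g s) u ^ 2 ≤
      heat (T - s) (deriv g) u ^ 2 + invScale n * K * (1 + u ^ 2)⁻¹ := by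
    intro n s hs u
    rw [(hg.isTest_truncHeat hT n).2.2.1 s]
    dsimp only
    rw [heatExt_of_nonneg g (sub_nonneg.2 hs.2), heatExt_of_nonneg (deriv g) (sub_nonneg.2 hs.2)]
    have a0 := h₀ (T - s) (by linarith [hs.1]) u
    have a1 := h₁ (T - s) (by linarith [hs.1]) u
    have a2 := abs_heat_le hB (T - s) u
    have a3 := hD (invScale n * u)
    have a4 := cut_nonneg (invScale n * u)
    have a5 := cut_le_one (invScale n * u)
    have a6 := cut_nonneg ((T + 1)⁻¹ * s)
    have a7 := cut_le_one ((T + 1)⁻¹ * s)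
    have e0 := (invScale_pos n).le
    have e1 := invScale_le_one n
    set F := heat (T - s) g u
    set F' := heat (T - s) (deriv g) u
    set q := (1 + u ^ 2)⁻¹
    set ε := invScale n
    have hq : 0 ≤ q := by positivity
    have b1 : |cut ((T + 1)⁻¹ * s) * (ε * deriv cut (ε * u) * F + cut (ε * u) * F')| ≤
        ε * (D * |F|) + |F'| := by
      rw [abs_mul, abs_of_nonneg a6]
      have c1 : |ε * deriv cut (ε * u) * F + cut (ε * u) * F'| ≤ ε * (D * |F|) + |F'| := by
        refine (abs_add_le _ _).trans (add_le_add ?_ ?_)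
        · rw [abs_mul, abs_mul, abs_of_nonneg e0, mul_assoc]
          gcongr
        · rw [abs_mul, abs_of_nonneg a4]
          exact mul_le_of_le_one_left (abs_nonneg _) a5
      exact (mul_le_of_le_one_left (abs_nonneg _) a7).trans c1
    rw [← sq_abs]
    have b2 : (ε * (D * |F|) + |F'|) ^ 2 ≤ F' ^ 2 + ε * K * q := by
      have d1 : |F| * |F'| ≤ B * (C₁ * q) := mul_le_mul a2 a1 (abs_nonneg _) hB0
      have d2 : |F| * |F| ≤ B * (C₀ * q) := mul_le_mul a2 a0 (abs_nonneg _) hB0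
      have d3 : ε * ε ≤ ε * 1 := mul_le_mul_of_nonneg_left e1 e0
      calc (ε * (D * |F|) + |F'|) ^ 2
          = |F'| ^ 2 + ε * (2 * D) * (|F| * |F'|) + (ε * ε) * (D ^ 2 * (|F| * |F|)) := by ring
        _ ≤ |F'| ^ 2 + ε * (2 * D) * (B * (C₁ * q)) + (ε * 1) * (D ^ 2 * (B * (C₀ * q))) := by
          gcongr
        _ = F' ^ 2 + ε * K * q := by rw [sq_abs, hK]; ring
    exact (pow_le_pow_left₀ (abs_nonneg _) b1 2).trans b2
  have hint : IntervalIntegrable (fun s => ∫ u, heat (T - s) (deriv g) u ^ 2) volume 0 T := by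
    refine ContinuousOn.intervalIntegrable ?_
    rw [uIcc_of_le hT]
    exact (hg.deriv.continuous_integral_heat_sq T).comp (by fun_prop) fun s hs => by
      simpa using hs.1
  refine ⟨T * (K * ∫ u : ℝ, (1 + u ^ 2)⁻¹), fun n => ?_⟩
  have hinn : ∀ s ∈ Icc 0 T, ∫ u, deriv (truncHeat T n g s) u ^ 2 ≤
      (∫ u, heat (T - s) (deriv g) u ^ 2) + invScale n * K * ∫ u : ℝ, (1 + u ^ 2)⁻¹ := by
    intro s hs
    have i1 : Integrable fun u => heat (T - s) (deriv g) u ^ 2 := by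
      simpa only [sq] using hg.deriv.integrable_heat_mul hg.deriv (T - s) (T - s)
    have i2 := integrable_inv_one_add_sq.const_mul (invScale n * K)
    rw [← integral_const_mul, ← integral_add i1 i2]
    exact integral_mono_of_nonneg (ae_of_all _ fun u => sq_nonneg _) (i1.add i2)
      (ae_of_all _ fun u => hpt n s hs u)
  have h2 : ∫ s in (0 : ℝ)..T, ∫ u, deriv (truncHeat T n g s) u ^ 2 ≤
      ∫ s in (0 : ℝ)..T, ((∫ u, heat (T - s) (deriv g) u ^ 2) +
        invScale n * K * ∫ u : ℝ, (1 + u ^ 2)⁻¹) := by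
    rw [intervalIntegral.integral_of_le hT, intervalIntegral.integral_of_le hT]
    refine integral_mono_of_nonneg (ae_of_all _ fun s => integral_nonneg fun u => sq_nonneg _)
      ((hint.add intervalIntegrable_const).1) ?_
    filter_upwards [ae_restrict_mem measurableSet_Ioc] with s hs
    exact hinn s ⟨hs.1.le, hs.2⟩
  refine h2.trans (le_of_eq ?_)
  rw [intervalIntegral.integral_add hint intervalIntegrable_const,
    intervalIntegral.integral_const]
  simp only [sub_zero, smul_eq_mul]
  ring

end TestFn

/-! ### Lower bound on the rate function for smooth test functions. -/

/-- Testing the rate function with the backward heat flow of a smooth function. -/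
theorem IsCadlag.le_Q {ρ T : ℝ} (hρ : 0 ≤ ρ * (1 - ρ)) (hT : 0 ≤ T) {μ : ℝ → TDist}
    (hμ : IsCadlag T μ) {g : ℝ → ℝ} (hg : TestFn g) :
    ((μ T hg.toSchwartz - μ 0 hg.toSchwartz - ρ * (1 - ρ) / 2 * heatForm T g : ℝ) : EReal) ≤
      Q ρ T μ := by
  set σ := ρ * (1 - ρ) with hσ
  obtain ⟨C₁, hC₁⟩ := hμ.bounded_cutHeat testFn_cut.deriv.deriv hg
  obtain ⟨C₂, hC₂⟩ := hμ.bounded_cutHeat testFn_cut.deriv hg.deriv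
  obtain ⟨C₃, hC₃⟩ := hg.energy_truncHeat_le hT
  have hC₁0 : 0 ≤ C₁ := (abs_nonneg _).trans (hC₁ 0 ⟨le_rfl, hT⟩ T le_rfl 0)
  have hT1 : ∀ s ∈ Icc 0 T, |(T + 1)⁻¹ * s| < 1 := by
    intro s hs
    rw [abs_of_nonneg (mul_nonneg (by positivity) hs.1), inv_mul_lt_iff₀ (by positivity)]
    linarith [hs.2]
  have hcT : ∀ s ∈ Icc 0 T, cut ((T + 1)⁻¹ * s) = 1 := fun s hs => cut_eq_one (hT1 s hs).le
  have main : ∀ᶠ n in atTop, ((μ T hg.toSchwartz - μ 0 hg.toSchwartz - σ / 2 * heatForm T g -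
      invScale n * ((C₁ + C₂) * T + σ / 2 * C₃) : ℝ) : EReal) ≤ Q ρ T μ := by
    filter_upwards [hg.eventually_cut_mul_eq] with n hn
    obtain ⟨t1, t2, t3, t4⟩ := hg.isTest_truncHeat hT n
    set ε := invScale n
    set H := (testFn_cut.cutHeat hg T n).toSchwartz
    have eT : truncHeat T n g T = ⇑hg.toSchwartz := by
      ext u
      rw [truncHeat, hcT T ⟨hT, le_rfl⟩, sub_self, heatExt_of_nonneg g le_rfl,
        heat_of_nonpos le_rfl, one_mul, hn]
      rfl
    have e0 : truncHeat T n g 0 = ⇑H := by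
      ext u
      rw [truncHeat, hcT 0 ⟨le_rfl, hT⟩, sub_zero, heatExt_of_nonneg g hT, one_mul]
      rfl
    -- On `[0, T]` the time cutoff is locally constant and the backward heat equation cancels the
    -- main terms. Only the terms with a derivative on the spatial cutoff remain.
    have es : ∀ s ∈ Icc 0 T, (fun u => deriv (fun r => truncHeat T n g r u) s +
        (1 / 2) * iteratedDeriv 2 (truncHeat T n g s) u) =
        ⇑((ε ^ 2 / 2) • (testFn_cut.deriv.deriv.cutHeat hg (T - s) n).toSchwartz +
          ε • (testFn_cut.deriv.cutHeat hg.deriv (T - s) n).toSchwartz) := by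
      intro s hs
      ext u
      have hs' : 0 ≤ T - s := sub_nonneg.2 hs.2
      rw [t2, t4, hcT s hs, deriv_cut_eq_zero (hT1 s hs)]
      dsimp only
      rw [heatExt_of_nonneg _ hs',
        heatExt_of_nonneg _ hs', heatExt_of_nonneg _ hs']
      change _ = ε ^ 2 / 2 * (deriv (deriv cut) (ε * u) * heat (T - s) g u) +
        ε * (deriv cut (ε * u) * heat (T - s) (deriv g) u)
      ring
    have hpair : ∀ s ∈ Icc 0 T, |pairing (μ s) fun u => deriv (fun r => truncHeat T n g r u) s +
        (1 / 2) * iteratedDeriv 2 (truncHeat T n g s) u| ≤ ε * (C₁ + C₂) := by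
      intro s hs
      have hε := (invScale_pos n).le
      have hε1 := invScale_le_one n
      rw [es s hs, pairing_schwartz]
      have hlin : μ s ((ε ^ 2 / 2) • (testFn_cut.deriv.deriv.cutHeat hg (T - s) n).toSchwartz +
          ε • (testFn_cut.deriv.cutHeat hg.deriv (T - s) n).toSchwartz) =
          ε ^ 2 / 2 * μ s (testFn_cut.deriv.deriv.cutHeat hg (T - s) n).toSchwartz +
          ε * μ s (testFn_cut.deriv.cutHeat hg.deriv (T - s) n).toSchwartz := by
        rw [map_add, map_smul, map_smul, smul_eq_mul, smul_eq_mul]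
      rw [hlin, mul_add]
      refine (abs_add_le _ _).trans (add_le_add ?_ ?_)
      · rw [abs_mul, abs_of_nonneg (by positivity)]
        have h1 := hC₁ s hs (T - s) (by linarith [hs.1]) n
        have h2 : ε ^ 2 / 2 ≤ ε := by nlinarith
        exact mul_le_mul h2 h1 (abs_nonneg _) hε
      · rw [abs_mul, abs_of_nonneg hε]
        exact mul_le_mul_of_nonneg_left (hC₂ s hs (T - s) (by linarith [hs.1]) n) hε
    -- The norm bound on the integral needs no measurability of the pairing in `s`.
    have hI : |∫ s in (0 : ℝ)..T, pairing (μ s) fun u =>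
        deriv (fun r => truncHeat T n g r u) s +
        (1 / 2) * iteratedDeriv 2 (truncHeat T n g s) u| ≤ ε * (C₁ + C₂) * T := by
      have := intervalIntegral.norm_integral_le_of_norm_le_const (a := 0) (b := T)
        (C := ε * (C₁ + C₂)) (f := fun s => pairing (μ s) fun u =>
          deriv (fun r => truncHeat T n g r u) s +
          (1 / 2) * iteratedDeriv 2 (truncHeat T n g s) u) (fun s hs => by
            rw [uIoc_of_le hT] at hs
            exact hpair s ⟨hs.1.le, hs.2⟩)
      simpa [abs_of_nonneg hT] using this
    have hφ := testFn_cut.cutHeat hg T n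
    have eφ : (fun u => cut (ε * u) * heat T g u - g u) = ⇑(H - hg.toSchwartz) := rfl
    -- For large `n` the cutoff equals `1` wherever `g ≠ 0`, so the static test function is the
    -- cutoff times `heat T g - g`, and truncation only decreases the square.
    have hφ2 : ∫ u, (cut (ε * u) * heat T g u - g u) ^ 2 ≤ ∫ u, (heat T g u - g u) ^ 2 := by
      refine integral_mono_of_nonneg (ae_of_all _ fun u => sq_nonneg _) ?_
        (ae_of_all _ fun u => ?_)
      · have i1 := hg.integrable_heat_mul hg T T
        have i2 := hg.integrable_heat_mul hg T 0
        have i3 := hg.integrable_heat_mul hg 0 0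
        rw [heat_of_nonpos le_rfl] at i2 i3
        refine ((i1.sub (i2.const_mul 2)).add i3).congr (ae_of_all _ fun u => ?_)
        simp only [Pi.add_apply, Pi.sub_apply]
        ring
      · have h1 : cut (ε * u) * heat T g u - g u = cut (ε * u) * (heat T g u - g u) := by
          rw [mul_sub, hn]
        dsimp only
        rw [h1, mul_pow]
        exact mul_le_of_le_one_left (sq_nonneg _)
          (pow_le_one₀ (cut_nonneg _) (cut_le_one _))
    have q1 := le_iSup₂_of_le (f := fun (G : ℝ → ℝ → ℝ) (_ : IsTest G) =>
      ((linPart T μ G - ρ * (1 - ρ) / 2 *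
        ∫ s in (0 : ℝ)..T, ∫ u, (deriv (G s) u) ^ 2 : ℝ) : EReal))
      (truncHeat T n g) t1 le_rfl
    have q2 := le_iSup₂_of_le (f := fun (φ : ℝ → ℝ) (_ : Continuous φ ∧ HasCompactSupport φ) =>
      ((pairing (μ 0) φ - ρ * (1 - ρ) / 2 * ∫ u, (φ u) ^ 2 : ℝ) : EReal))
      (fun u => cut (ε * u) * heat T g u - g u)
      ⟨hφ.continuous.sub hg.continuous, hφ.compact.sub hg.compact⟩ le_rfl
    refine le_trans ?_ (add_le_add q1 q2)
    rw [← EReal.coe_add, EReal.coe_le_coe_iff, ← hσ, linPart, eT, e0, eφ, pairing_schwartz,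
      pairing_schwartz, pairing_schwartz, map_sub]
    have hen := hg.energy_eq hT
    have h1 := hC₃ n
    have h2 := (abs_le.1 hI).2
    have h3 : σ / 2 * ((∫ s in (0 : ℝ)..T, ∫ u, deriv (truncHeat T n g s) u ^ 2) +
        ∫ u, (cut (ε * u) * heat T g u - g u) ^ 2) ≤
        σ / 2 * (heatForm T g + ε * C₃) :=
      mul_le_mul_of_nonneg_left (by linarith) (by linarith)
    linarith
  have hlim : Tendsto (fun n => ((μ T hg.toSchwartz - μ 0 hg.toSchwartz - σ / 2 * heatForm T g -
      invScale n * ((C₁ + C₂) * T + σ / 2 * C₃) : ℝ) : EReal)) atTop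
      (𝓝 ((μ T hg.toSchwartz - μ 0 hg.toSchwartz - σ / 2 * heatForm T g : ℝ) : EReal)) := by
    refine (continuous_coe_real_ereal.tendsto _).comp ?_
    simpa using (tendsto_invScale.mul_const ((C₁ + C₂) * T + σ / 2 * C₃)).const_sub
      (μ T hg.toSchwartz - μ 0 hg.toSchwartz - σ / 2 * heatForm T g)
  exact le_of_tendsto hlim main

/-! ### The Dirichlet form of a smoothed half-line cutoff. -/

theorem gauss_zero : gauss 0 = (√(2 * Real.pi))⁻¹ := by simp [gauss_eq]

theorem tendsto_gauss_atTop : Tendsto gauss atTop (𝓝 0) := by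
  have h : Tendsto (fun z : ℝ => (√(2 * Real.pi))⁻¹ * Real.exp (-(1 / 2 * z ^ 2))) atTop
      (𝓝 ((√(2 * Real.pi))⁻¹ * 0)) := by
    refine (Real.tendsto_exp_neg_atTop_nhds_zero.comp ?_).const_mul _
    exact (tendsto_pow_atTop two_ne_zero).const_mul_atTop (by norm_num)
  rw [mul_zero] at h
  refine h.congr fun z => ?_
  rw [gauss_eq]
  ring_nf

theorem integral_Ioi_id_mul_gauss (x : ℝ) : ∫ z in Ioi x, z * gauss z = gauss x := by
  have := integral_Ioi_of_hasDerivAt_of_tendsto' (a := x) (f := fun z => -gauss z)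
    (f' := fun z => z * gauss z) (m := -0) (fun z _ =>
      ((hasDerivAt_gauss z).neg).congr_deriv (neg_neg _)) integrable_id_mul_gauss.integrableOn
    tendsto_gauss_atTop.neg
  rw [this]; simp

theorem integral_abs_gaussian : ∫ z, |z| ∂gaussianReal 0 1 = √(2 / Real.pi) := by
  rw [integral_gaussian]
  have h : ∀ z, gauss z * |z| = (fun y => gauss y * y) |z| := fun z => by
    rcases abs_choice z with h | h <;> simp [h, gauss_neg]
  simp only [h]
  rw [integral_comp_abs (f := fun y => gauss y * y)]
  simp only [mul_comm (gauss _)]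
  rw [integral_Ioi_id_mul_gauss, gauss_zero, Real.sqrt_div zero_le_two, Real.sqrt_mul zero_le_two]
  have : √2 * √2 = 2 := Real.mul_self_sqrt zero_le_two
  field_simp
  linarith

theorem integrable_abs_gaussian : Integrable (fun z : ℝ => |z|) (gaussianReal 0 1) := by
  simpa using integrable_add_mul_abs_pow_gaussian 0 1 1

theorem integrable_sq_gaussian : Integrable (fun z : ℝ => z ^ 2) (gaussianReal 0 1) := by
  simpa using integrable_add_mul_abs_pow_gaussian 0 1 2

namespace TestFn

variable {g : ℝ → ℝ}

theorem integrable_shift_mul (hg : TestFn g) (y : ℝ) : Integrable fun u => g (u + y) * g u := by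
  obtain ⟨B, hB⟩ := hg.bounded
  exact hg.integrable.bdd_mul (c := B)
    (hg.continuous.comp (by fun_prop)).aestronglyMeasurable (ae_of_all _ fun u => hB _)

theorem integrable_sq (hg : TestFn g) : Integrable fun u => g u ^ 2 := by
  simpa [sq] using hg.integrable_shift_mul 0

theorem integral_shift_sub_sq (hg : TestFn g) (y : ℝ) :
    ∫ u, (g (u + y) - g u) ^ 2 = 2 * (∫ u, g u ^ 2) - 2 * ∫ u, g (u + y) * g u := by
  have i1 : Integrable fun u => g (u + y) ^ 2 := hg.integrable_sq.comp_add_right y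
  have e1 : ∫ u, g (u + y) ^ 2 = ∫ u, g u ^ 2 :=
    integral_add_right_eq_self (fun u => g u ^ 2) y
  have : ∀ u, (g (u + y) - g u) ^ 2 = g (u + y) ^ 2 + g u ^ 2 - 2 * (g (u + y) * g u) :=
    fun u => by ring
  simp only [this]
  rw [integral_sub (f := fun u => g (u + y) ^ 2 + g u ^ 2) (i1.add hg.integrable_sq) ((hg.integrable_shift_mul y).const_mul 2),
    integral_add i1 hg.integrable_sq, integral_const_mul, e1]
  ring

theorem integrable_prod_shift_mul (hg : TestFn g) (T : ℝ) :
    Integrable (fun p : ℝ × ℝ => g (p.2 + √T * p.1) * g p.2)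
      ((gaussianReal 0 1).prod volume) := by
  obtain ⟨B, hB⟩ := hg.bounded
  have hc := hg.continuous
  refine Integrable.bdd_mul (c := B) ?_ ?_ (ae_of_all _ fun u => hB _)
  · exact hg.integrable.comp_snd (gaussianReal 0 1)
  · exact Continuous.aestronglyMeasurable (by fun_prop)

/-- Expanding the square and using translation invariance and Fubini. In this form only increments
of `g` matter, so a jump costs a finite amount and no derivative of `g` enters. -/
theorem heatForm_eq (hg : TestFn g) (T : ℝ) :
    heatForm T g = ∫ z, (∫ u, (g (u + √T * z) - g u) ^ 2) ∂gaussianReal 0 1 := by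
  have h1 := hg.integrable_prod_shift_mul T
  have h2 := integral_integral_swap (f := fun z u => g (u + √T * z) * g u) h1
  simp only [hg.integral_shift_sub_sq]
  rw [integral_sub (integrable_const _) (h1.integral_prod_left.const_mul 2), heatForm]
  simp only [integral_const_mul]
  rw [h2]
  simp only [integral_mul_const, integral_const, probReal_univ, one_smul]
  rfl

theorem integrable_integral_shift_sub_sq (hg : TestFn g) (T : ℝ) :
    Integrable (fun z => ∫ u, (g (u + √T * z) - g u) ^ 2) (gaussianReal 0 1) := by
  simp only [hg.integral_shift_sub_sq]
  exact (integrable_const _).sub ((hg.integrable_prod_shift_mul T).integral_prod_left.const_mul 2)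

/-- For `y ≥ 0`, the increment is at most `1` on the interval of length `y + 2ε` around the jump, at
most `y / N` on the following interval of length `N`, and zero elsewhere. Negative `y` reduces to
this by translation. -/
theorem integral_shift_sub_sq_le {N ε : ℝ} (hN : 0 < N) (hε : 0 ≤ ε)
    (h0 : ∀ u, 0 ≤ g u) (h1 : ∀ u, g u ≤ 1) (hl : ∀ u ≤ -ε, g u = 0) (hr : ∀ u ≥ N + ε, g u = 0)
    (hL : ∀ u ≥ ε, ∀ v ≥ ε, |g u - g v| ≤ |u - v| / N) (y : ℝ) :
    ∫ u, (g (u + y) - g u) ^ 2 ≤ |y| + 2 * ε + y ^ 2 / N := by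
  have pos : ∀ y, 0 ≤ y → ∫ u, (g (u + y) - g u) ^ 2 ≤ y + 2 * ε + y ^ 2 / N := by
    intro y hy
    have i1 : Integrable ((Icc (-y - ε) ε).indicator fun _ => (1 : ℝ)) :=
      (integrable_indicator_iff measurableSet_Icc).2 (by simp)
    have i2 : Integrable ((Icc ε (N + ε)).indicator fun _ => (y / N) ^ 2) :=
      (integrable_indicator_iff measurableSet_Icc).2 (by simp)
    have hle : ∫ u, (g (u + y) - g u) ^ 2 ≤ ∫ u, ((Icc (-y - ε) ε).indicator (fun _ => (1 : ℝ)) u +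
        (Icc ε (N + ε)).indicator (fun _ => (y / N) ^ 2) u) := by
      refine integral_mono_of_nonneg (ae_of_all _ fun u => sq_nonneg _) (i1.add i2)
        (ae_of_all _ fun u => ?_)
      dsimp only
      have p1 : 0 ≤ (Icc (-y - ε) ε).indicator (fun _ => (1 : ℝ)) u :=
        indicator_nonneg (fun _ _ => zero_le_one) u
      have p2 : 0 ≤ (Icc ε (N + ε)).indicator (fun _ => (y / N) ^ 2) u :=
        indicator_nonneg (fun _ _ => sq_nonneg _) u
      rcases lt_or_ge u (-y - ε) with a | a
      · rw [hl u (by linarith), hl (u + y) (by linarith)]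
        simp only [sub_self, ne_eq, OfNat.ofNat_ne_zero, not_false_eq_true, zero_pow]
        linarith
      rcases le_or_gt u ε with b | b
      · have : (g (u + y) - g u) ^ 2 ≤ 1 := by
          rw [sq_le_one_iff_abs_le_one, abs_le]
          constructor <;> linarith [h0 u, h0 (u + y), h1 u, h1 (u + y)]
        rw [indicator_of_mem (show u ∈ Icc (-y - ε) ε from ⟨a, b⟩)]
        linarith
      rcases le_or_gt u (N + ε) with c | c
      · have h3 := hL (u + y) (by linarith) u b.le
        rw [add_sub_cancel_left, abs_of_nonneg hy] at h3
        rw [indicator_of_mem (show u ∈ Icc ε (N + ε) from ⟨b.le, c⟩), ← sq_abs]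
        have := pow_le_pow_left₀ (abs_nonneg _) h3 2
        linarith
      · rw [hr u c.le, hr (u + y) (by linarith)]
        simp only [sub_self, ne_eq, OfNat.ofNat_ne_zero, not_false_eq_true, zero_pow]
        linarith
    refine hle.trans (le_of_eq ?_)
    rw [integral_add i1 i2, integral_indicator_const _ measurableSet_Icc,
      integral_indicator_const _ measurableSet_Icc, Real.volume_real_Icc_of_le (by linarith),
      Real.volume_real_Icc_of_le (by linarith)]
    simp only [smul_eq_mul]
    field_simp
    ring
  rcases le_total 0 y with hy | hy
  · rw [abs_of_nonneg hy]; exact pos y hy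
  · have h2 := pos (-y) (by linarith)
    have h3 := integral_add_right_eq_self (μ := volume) (fun u => (g (u + -y) - g u) ^ 2) y
    simp only [add_neg_cancel_right] at h3
    rw [abs_of_nonpos hy, ← neg_sq y]
    refine le_trans (le_of_eq ?_) h2
    rw [← h3]
    congr 1; ext u; ring

/-- Average the bound on increments over `y = √T z`. The main term is `√T E|Z|`. -/
theorem heatForm_le (hg : TestFn g) {N ε : ℝ} (hN : 0 < N) (hε : 0 ≤ ε)
    (h0 : ∀ u, 0 ≤ g u) (h1 : ∀ u, g u ≤ 1) (hl : ∀ u ≤ -ε, g u = 0) (hr : ∀ u ≥ N + ε, g u = 0)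
    (hL : ∀ u ≥ ε, ∀ v ≥ ε, |g u - g v| ≤ |u - v| / N) {T : ℝ} (hT : 0 ≤ T) :
    heatForm T g ≤ √(2 * T / Real.pi) + 2 * ε +
      (T * ∫ z, z ^ 2 ∂gaussianReal 0 1) / N := by
  rw [hg.heatForm_eq]
  have i1 : Integrable (fun z : ℝ => √T * |z| + 2 * ε) (gaussianReal 0 1) :=
    (integrable_abs_gaussian.const_mul _).add (integrable_const _)
  have i2 : Integrable (fun z : ℝ => T / N * z ^ 2) (gaussianReal 0 1) :=
    integrable_sq_gaussian.const_mul _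
  refine (integral_mono (hg.integrable_integral_shift_sub_sq T) (i1.add i2) fun z => ?_).trans
    (le_of_eq ?_)
  · refine (integral_shift_sub_sq_le hN hε h0 h1 hl hr hL (√T * z)).trans (le_of_eq ?_)
    simp only [Pi.add_apply]
    rw [abs_mul, abs_of_nonneg (Real.sqrt_nonneg T), mul_pow, Real.sq_sqrt hT]
    ring
  · simp only [Pi.add_apply]
    rw [integral_add i1 i2, integral_add (integrable_abs_gaussian.const_mul _) (integrable_const _),
      show 2 * T / Real.pi = T * (2 / Real.pi) by ring, Real.sqrt_mul hT]
    simp only [integral_const_mul, integral_const, integral_abs_gaussian, probReal_univ,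
      smul_eq_mul]
    ring

end TestFn

theorem cutoff_nonneg (N : ℕ) (u : ℝ) : 0 ≤ cutoff N u :=
  indicator_nonneg (fun _ _ => le_max_right _ _) u

theorem cutoff_le_one (N : ℕ) (u : ℝ) : cutoff N u ≤ 1 := by
  by_cases h : u ∈ Ici (0 : ℝ)
  · have : 0 ≤ u / N := div_nonneg h N.cast_nonneg
    rw [cutoff, indicator_of_mem h]
    exact max_le (by linarith) zero_le_one
  · rw [cutoff, indicator_of_notMem h]; exact zero_le_one

theorem cutoff_of_neg (N : ℕ) {u : ℝ} (hu : u < 0) : cutoff N u = 0 :=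
  indicator_of_notMem (by simpa using hu) _

theorem cutoff_of_ge {N : ℕ} (hN : 0 < N) {u : ℝ} (hu : (N : ℝ) ≤ u) : cutoff N u = 0 := by
  have hN' : (0 : ℝ) < N := by exact_mod_cast hN
  rw [cutoff, indicator_of_mem (show u ∈ Ici (0 : ℝ) from hN'.le.trans hu)]
  refine max_eq_right ?_
  rw [sub_nonpos, le_div_iff₀ hN']
  linarith

theorem abs_cutoff_sub_le {N : ℕ} {u v : ℝ} (hu : 0 ≤ u) (hv : 0 ≤ v) :
    |cutoff N u - cutoff N v| ≤ |u - v| / N := by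
  rw [cutoff, indicator_of_mem (show u ∈ Ici (0 : ℝ) from hu),
    indicator_of_mem (show v ∈ Ici (0 : ℝ) from hv)]
  refine (abs_max_sub_max_le_abs _ _ _).trans (le_of_eq ?_)
  rw [show (1 - u / N) - (1 - v / N) = -((u - v) / N) by ring, abs_neg, abs_div,
    abs_of_nonneg (N.cast_nonneg (α := ℝ))]

theorem measurable_cutoff (N : ℕ) : Measurable (cutoff N) :=
  Measurable.indicator (by fun_prop) measurableSet_Ici

theorem cutoff_eq_zero {N : ℕ} (hN : 0 < N) {u : ℝ} (hu : u ∉ Icc (0 : ℝ) N) :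
    cutoff N u = 0 := by
  rw [mem_Icc, not_and_or, not_le, not_le] at hu
  rcases hu with h | h
  · exact cutoff_of_neg N h
  · exact cutoff_of_ge hN h.le

theorem hasCompactSupport_cutoff {N : ℕ} (hN : 0 < N) : HasCompactSupport (cutoff N) :=
  HasCompactSupport.intro isCompact_Icc fun _ hu => cutoff_eq_zero hN hu

theorem locallyIntegrable_cutoff (N : ℕ) : LocallyIntegrable (cutoff N) :=
  (locallyIntegrable_const (1 : ℝ)).mono (measurable_cutoff N).aestronglyMeasurable
    (ae_of_all _ fun u => by
      rw [Real.norm_of_nonneg (cutoff_nonneg N u), norm_one]; exact cutoff_le_one N u)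

/-- Smooth bumps shrinking to the origin. -/
def bump (k : ℕ) : ContDiffBump (0 : ℝ) :=
  ⟨invScale k / 2, invScale k, by have := invScale_pos k; linarith,
    by have := invScale_pos k; linarith⟩

/-- A mollification of the cutoff of the half line. -/
def smoothCutoff (N k : ℕ) : ℝ → ℝ :=
  convolution ((bump k).normed volume) (cutoff N) (ContinuousLinearMap.lsmul ℝ ℝ) volume

theorem testFn_smoothCutoff {N : ℕ} (hN : 0 < N) (k : ℕ) : TestFn (smoothCutoff N k) :=
  ⟨HasCompactSupport.contDiff_convolution_left _ (bump k).hasCompactSupport_normed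
    (bump k).contDiff_normed (locallyIntegrable_cutoff N),
   (bump k).hasCompactSupport_normed.convolution _ (hasCompactSupport_cutoff hN)⟩

theorem abs_smoothCutoff_sub_le {N k : ℕ} {u z ε : ℝ} (hε : 0 ≤ ε)
    (h : ∀ v, |v - u| < invScale k → |cutoff N v - z| ≤ ε) : |smoothCutoff N k u - z| ≤ ε := by
  have := dist_convolution_le (g := cutoff N) (z₀ := z) (x₀ := u) (μ := volume) hε
    (bump k).support_normed_eq.subset (bump k).nonneg_normed (bump k).integral_normed
    (measurable_cutoff N).aestronglyMeasurable (fun v hv => by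
      rw [Real.dist_eq]
      exact h v (by rwa [Metric.mem_ball, Real.dist_eq] at hv))
  rwa [Real.dist_eq] at this

theorem smoothCutoff_mem_Icc (N k : ℕ) (u : ℝ) : smoothCutoff N k u ∈ Icc (0 : ℝ) 1 := by
  have := abs_smoothCutoff_sub_le (N := N) (k := k) (u := u) (z := 1 / 2) (ε := 1 / 2)
    (by norm_num) fun v _ => by
      rw [abs_le]
      constructor <;> linarith [cutoff_nonneg N v, cutoff_le_one N v]
  rw [abs_le] at this
  constructor <;> linarith

theorem smoothCutoff_eq_zero {N k : ℕ} {u : ℝ}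
    (h : ∀ v, |v - u| < invScale k → cutoff N v = 0) : smoothCutoff N k u = 0 := by
  have := abs_smoothCutoff_sub_le (N := N) (k := k) (u := u) (z := 0) (ε := 0) le_rfl fun v hv => by
    rw [h v hv]; simp
  simpa using this

theorem smoothCutoff_of_le (N k : ℕ) {u : ℝ} (hu : u ≤ -invScale k) : smoothCutoff N k u = 0 :=
  smoothCutoff_eq_zero fun v hv => cutoff_of_neg N (by linarith [(abs_lt.1 hv).2])

theorem smoothCutoff_of_ge {N : ℕ} (hN : 0 < N) (k : ℕ) {u : ℝ} (hu : u ≥ N + invScale k) :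
    smoothCutoff N k u = 0 :=
  smoothCutoff_eq_zero fun v hv => cutoff_of_ge hN (by linarith [(abs_lt.1 hv).1])

/-- At distance at least `invScale k` to the right of the jump, mollification averages only values
on the nonnegative side, where the cutoff has Lipschitz constant `1 / N`. -/
theorem abs_smoothCutoff_sub_smoothCutoff_le (N k : ℕ) {u v : ℝ} (hu : invScale k ≤ u)
    (hv : invScale k ≤ v) : |smoothCutoff N k u - smoothCutoff N k v| ≤ |u - v| / N := by
  have hi : ∀ u, Integrable fun t => (bump k).normed volume t * cutoff N (u - t) := fun u => by
    refine ((bump k).integrable_normed (μ := volume)).mul_bdd (c := 1)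
      ((measurable_cutoff N).comp (by fun_prop)).aestronglyMeasurable (ae_of_all _ fun t => ?_)
    rw [Real.norm_of_nonneg (cutoff_nonneg N _)]; exact cutoff_le_one N _
  have e : ∀ u, smoothCutoff N k u = ∫ t, (bump k).normed volume t * cutoff N (u - t) :=
    fun u => rfl
  rw [e, e, ← integral_sub (hi u) (hi v)]
  have h1 : ∫ t, (bump k).normed volume t * (|u - v| / N) = |u - v| / N := by
    rw [integral_mul_const, (bump k).integral_normed, one_mul]
  rw [← h1, ← Real.norm_eq_abs]
  refine norm_integral_le_of_norm_le (((bump k).integrable_normed (μ := volume)).mul_const _)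
    (ae_of_all _ fun t => ?_)
  rw [← mul_sub, norm_mul, Real.norm_of_nonneg ((bump k).nonneg_normed t)]
  by_cases ht : (bump k).normed volume t = 0
  · rw [ht]; simp
  · have ht' : t ∈ Metric.ball (0 : ℝ) (invScale k) := by
      have : t ∈ Function.support ((bump k).normed volume) := ht
      rwa [(bump k).support_normed_eq] at this
    rw [mem_ball_zero_iff, Real.norm_eq_abs, abs_lt] at ht'
    refine mul_le_mul_of_nonneg_left ?_ ((bump k).nonneg_normed t)
    refine (abs_cutoff_sub_le (by linarith) (by linarith)).trans (le_of_eq ?_)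
    rw [sub_sub_sub_cancel_right]

theorem heatForm_smoothCutoff_le {N : ℕ} (hN : 0 < N) (k : ℕ) {T : ℝ} (hT : 0 ≤ T) :
    heatForm T (smoothCutoff N k) ≤ √(2 * T / Real.pi) + 2 * invScale k +
      (T * ∫ z, z ^ 2 ∂gaussianReal 0 1) / N :=
  (testFn_smoothCutoff hN k).heatForm_le (by exact_mod_cast hN) (invScale_pos k).le
    (fun u => (smoothCutoff_mem_Icc N k u).1) (fun u => (smoothCutoff_mem_Icc N k u).2)
    (fun _ hu => smoothCutoff_of_le N k hu) (fun _ hu => smoothCutoff_of_ge hN k hu)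
    (fun _ hu _ hv => abs_smoothCutoff_sub_smoothCutoff_le N k hu hv) hT

theorem tendsto_smoothCutoff (N : ℕ) {u : ℝ} (hu : u ≠ 0) :
    Tendsto (fun k => smoothCutoff N k u) atTop (𝓝 (cutoff N u)) := by
  have hlim : Tendsto (fun k => invScale k / N) atTop (𝓝 0) := by
    simpa using tendsto_invScale.div_const (N : ℝ)
  rw [tendsto_iff_dist_tendsto_zero]
  refine squeeze_zero' (Eventually.of_forall fun _ => dist_nonneg) ?_ hlim
  filter_upwards [tendsto_invScale.eventually (gt_mem_nhds (abs_pos.2 hu))] with k hk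
  rw [Real.dist_eq]
  refine abs_smoothCutoff_sub_le (div_nonneg (invScale_pos k).le N.cast_nonneg) fun v hv => ?_
  rcases lt_or_gt_of_ne hu with h | h
  · rw [abs_of_neg h] at hk
    rw [cutoff_of_neg N h, cutoff_of_neg N (by linarith [(abs_lt.1 hv).2])]
    simpa using div_nonneg (invScale_pos k).le N.cast_nonneg
  · rw [abs_of_pos h] at hk
    refine (abs_cutoff_sub_le (by linarith [(abs_lt.1 hv).1]) h.le).trans ?_
    exact div_le_div_of_nonneg_right hv.le N.cast_nonneg

theorem tendsto_integral_smoothCutoff {f : ℝ → ℝ} (hf : LocallyIntegrable f) {N : ℕ} (hN : 0 < N) :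
    Tendsto (fun k => ∫ u, f u * smoothCutoff N k u) atTop (𝓝 (∫ u, f u * cutoff N u)) := by
  refine tendsto_integral_of_dominated_convergence
    (fun u => (Icc (-1 : ℝ) (N + 1)).indicator (fun u => |f u|) u) (fun k => ?_) ?_ (fun k => ?_) ?_
  · exact hf.aestronglyMeasurable.mul (testFn_smoothCutoff hN k).continuous.aestronglyMeasurable
  · exact (integrable_indicator_iff measurableSet_Icc).2
      ((hf.integrableOn_isCompact isCompact_Icc).abs)
  · refine ae_of_all _ fun u => ?_
    have hk := invScale_le_one k
    by_cases hu : u ∈ Icc (-1 : ℝ) (N + 1)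
    · rw [indicator_of_mem hu, norm_mul, Real.norm_of_nonneg (smoothCutoff_mem_Icc N k u).1]
      exact mul_le_of_le_one_right (abs_nonneg _) (smoothCutoff_mem_Icc N k u).2
    · rw [indicator_of_notMem hu]
      rw [mem_Icc, not_and_or, not_le, not_le] at hu
      rcases hu with h | h
      · rw [smoothCutoff_of_le N k (by linarith)]; simp
      · rw [smoothCutoff_of_ge hN k (by linarith)]; simp
  · have : ∀ᵐ u : ℝ, u ≠ 0 := by simp [ae_iff]
    filter_upwards [this] with u hu
    exact (tendsto_smoothCutoff N hu).const_mul _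

theorem heatForm_const_mul (T c : ℝ) (g : ℝ → ℝ) :
    heatForm T (fun u => c * g u) = c ^ 2 * heatForm T g := by
  have h1 : ∀ u, heat T (fun u => c * g u) u = c * heat T g u := fun u => integral_const_mul _ _
  simp only [heatForm, h1, mul_pow, integral_const_mul]
  have h2 : ∀ u, c * heat T g u * (c * g u) = c ^ 2 * (heat T g u * g u) := fun u => by ring
  simp only [h2, integral_const_mul]
  ring

theorem TestFn.const_mul {g : ℝ → ℝ} (hg : TestFn g) (c : ℝ) : TestFn fun u => c * g u :=
  ⟨contDiff_const.mul hg.smooth, hg.compact.mul_left⟩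

/-! ### The lower bound under the gain constraint. -/

theorem le_Q_of_halfLineGain {ρ T a : ℝ} (hρ : 0 < ρ * (1 - ρ)) (hT : 0 < T) {μ : ℝ → TDist}
    (hμ : IsCadlag T μ) (ha : HalfLineGain (μ T) (μ 0) a) :
    ((a ^ 2 / (2 * (ρ * (1 - ρ)) * √(2 * T / Real.pi)) : ℝ) : EReal) ≤ Q ρ T μ := by
  obtain ⟨f₁, f₀, h₁, h₀, hlim⟩ := ha
  set σ := ρ * (1 - ρ)
  set K := √(2 * T / Real.pi) with hK
  set m := ∫ z, z ^ 2 ∂gaussianReal 0 1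
  have hK0 : 0 < K := Real.sqrt_pos.2 (by positivity)
  -- The maximizer of `c * a - σ / 2 * c ^ 2 * K`.
  set c := a / (σ * K) with hc
  have step1 : ∀ N : ℕ, 0 < N → ∀ k,
      ((c * ((∫ u, f₁ u * smoothCutoff N k u) - ∫ u, f₀ u * smoothCutoff N k u) -
        σ / 2 * (c ^ 2 * (K + 2 * invScale k + T * m / N)) : ℝ) : EReal) ≤ Q ρ T μ := by
    intro N hN k
    have hg := testFn_smoothCutoff hN k
    have hcg := hg.const_mul c
    refine le_trans ?_ (hμ.le_Q hρ.le hT.le hcg)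
    rw [EReal.coe_le_coe_iff, h₁.2 hcg.toSchwartz hcg.compact, h₀.2 hcg.toSchwartz hcg.compact, heatForm_const_mul]
    have e : ∀ f : ℝ → ℝ, ∫ u, f u * hcg.toSchwartz u = c * ∫ u, f u * smoothCutoff N k u := by
      intro f
      rw [← integral_const_mul]
      congr 1; ext u
      rw [hcg.coe_toSchwartz]; ring
    rw [e, e, ← mul_sub]
    have := heatForm_smoothCutoff_le hN k hT.le
    gcongr
  -- The mollification is removed first, at fixed `N`, where local integrability of the densities is
  -- enough. Only then does `N` tend to infinity, as the gain constraint prescribes.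
  have step2 : ∀ N : ℕ, 0 < N →
      ((c * ((∫ u, f₁ u * cutoff N u) - ∫ u, f₀ u * cutoff N u) -
        σ / 2 * (c ^ 2 * (K + T * m / N)) : ℝ) : EReal) ≤ Q ρ T μ := by
    intro N hN
    refine le_of_tendsto (x := atTop) ((continuous_coe_real_ereal.tendsto _).comp ?_)
      (Eventually.of_forall (step1 N hN))
    have l1 := (tendsto_integral_smoothCutoff h₁.1 hN).sub (tendsto_integral_smoothCutoff h₀.1 hN)
    have l2 := (((tendsto_invScale.const_mul 2).const_add K).add_const (T * m / N)).const_mul (c ^ 2)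
    simpa using (l1.const_mul c).sub (l2.const_mul (σ / 2))
  have hfin : a ^ 2 / (2 * σ * K) = c * a - σ / 2 * (c ^ 2 * (K + 0)) := by
    rw [hc]; field_simp; ring
  rw [hfin]
  refine le_of_tendsto (x := atTop) ((continuous_coe_real_ereal.tendsto _).comp ?_)
    ((eventually_gt_atTop 0).mono step2)
  have l3 : Tendsto (fun N : ℕ => T * m / N) atTop (𝓝 0) := tendsto_const_div_atTop_nhds_zero_nat _
  exact (hlim.const_mul c).sub (((l3.const_add K).const_mul (c ^ 2)).const_mul (σ / 2))

/-! ### Integrals of the Gaussian tail. -/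

/-- The tail of the standard Gaussian distribution. -/
def gaussTail (x : ℝ) : ℝ := ∫ z in Ioi x, gauss z

theorem gaussTail_nonneg (x : ℝ) : 0 ≤ gaussTail x :=
  integral_nonneg fun z => (gauss_pos z).le

theorem integral_gauss : ∫ z, gauss z = 1 := integral_gaussianPDFReal_eq_one 0 one_ne_zero

theorem gaussTail_le_one (x : ℝ) : gaussTail x ≤ 1 := by
  rw [← integral_gauss]
  exact setIntegral_le_integral integrable_gauss (ae_of_all _ fun z => (gauss_pos z).le)

theorem gaussTail_zero : gaussTail 0 = 1 / 2 := by
  have h := integral_comp_abs (f := gauss)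
  have e : ∀ z, gauss |z| = gauss z := fun z => by
    rcases abs_choice z with h | h <;> simp [h, gauss_neg]
  simp only [e, integral_gauss] at h
  rw [gaussTail]; linarith

theorem gaussTail_neg (x : ℝ) : gaussTail (-x) = 1 - gaussTail x := by
  have h1 := integral_comp_neg_Iic x gauss
  simp only [gauss_neg] at h1
  have h2 := integral_add_compl (measurableSet_Iic (a := x)) integrable_gauss
  rw [compl_Iic, integral_gauss, h1] at h2
  simp only [gaussTail]; linarith

theorem hasDerivAt_gaussTail (x : ℝ) : HasDerivAt gaussTail (-gauss x) x := by
  have h : gaussTail = fun y => gaussTail 0 - ∫ z in (0 : ℝ)..y, gauss z := by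
    ext y
    have := intervalIntegral.integral_Ioi_sub_Ioi' (a := (0 : ℝ)) (b := y) (μ := volume)
      integrable_gauss.integrableOn integrable_gauss.integrableOn
    simp only [gaussTail]; linarith
  rw [h]
  exact (intervalIntegral.integral_hasDerivAt_right integrable_gauss.intervalIntegrable
    (continuous_gauss.stronglyMeasurableAtFilter _ _) continuous_gauss.continuousAt).const_sub _

theorem continuous_gaussTail : Continuous gaussTail :=
  continuous_iff_continuousAt.2 fun x => (hasDerivAt_gaussTail x).continuousAt

/-- For `x ≥ 1` the tail is at most `∫ z gauss z` over `(x, ∞)`, which is `gauss x`. On `[0, 1)` the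
density is bounded below by `gauss 1`. -/
theorem exists_gaussTail_le : ∃ C, ∀ x, 0 ≤ x → gaussTail x ≤ C * gauss x := by
  refine ⟨max 1 (gauss 1)⁻¹, fun x hx => ?_⟩
  rcases le_or_gt 1 x with h | h
  · have h1 : gaussTail x ≤ gauss x := by
      rw [gaussTail, ← integral_Ioi_id_mul_gauss x]
      refine setIntegral_mono_on integrable_gauss.integrableOn
        integrable_id_mul_gauss.integrableOn measurableSet_Ioi fun z hz => ?_
      exact le_mul_of_one_le_left (gauss_pos z).le (h.trans (le_of_lt hz))
    exact h1.trans (le_mul_of_one_le_left (gauss_pos x).le (le_max_left _ _))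
  · have h2 : gauss 1 ≤ gauss x := by
      rw [gauss_eq, gauss_eq]
      gcongr ?_ * Real.exp ?_
      nlinarith
    have h3 : 1 ≤ (gauss 1)⁻¹ * gauss x := by
      rw [← div_eq_inv_mul, le_div_iff₀ (gauss_pos 1)]; linarith
    exact (gaussTail_le_one x).trans (h3.trans
      (mul_le_mul_of_nonneg_right (le_max_right _ _) (gauss_pos x).le))

theorem integrableOn_gaussTail : IntegrableOn gaussTail (Ioi 0) := by
  obtain ⟨C, hC⟩ := exists_gaussTail_le
  refine Integrable.mono' (integrable_gauss.const_mul C).integrableOn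
    continuous_gaussTail.aestronglyMeasurable ?_
  filter_upwards [ae_restrict_mem measurableSet_Ioi] with x hx
  rw [Real.norm_of_nonneg (gaussTail_nonneg x)]
  exact hC x (le_of_lt hx)

theorem tendsto_id_mul_gauss_atTop : Tendsto (fun x => x * gauss x) atTop (𝓝 0) := by
  have h : Tendsto (fun x : ℝ => (√(2 * Real.pi))⁻¹ * (x * Real.exp (-(1 / 2) * x ^ 2))) atTop
      (𝓝 ((√(2 * Real.pi))⁻¹ * 0)) := by
    refine Tendsto.const_mul _ ?_
    have h1 := rpow_mul_exp_neg_mul_sq_isLittleO_exp_neg (b := 1 / 2) (by norm_num) 1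
    have h2 : Tendsto (fun x : ℝ => Real.exp (-(1 / 2) * x)) atTop (𝓝 0) :=
      Real.tendsto_exp_atBot.comp (tendsto_id.const_mul_atTop_of_neg (by norm_num))
    simpa using h1.isBigO.trans_tendsto h2
  rw [mul_zero] at h
  refine h.congr fun x => ?_
  rw [gauss_eq]; ring

theorem tendsto_id_mul_gaussTail_atTop : Tendsto (fun x => x * gaussTail x) atTop (𝓝 0) := by
  obtain ⟨C, hC⟩ := exists_gaussTail_le
  have h : Tendsto (fun x => C * (x * gauss x)) atTop (𝓝 0) := by
    simpa using tendsto_id_mul_gauss_atTop.const_mul C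
  refine squeeze_zero' ?_ ?_ h
  · filter_upwards [eventually_ge_atTop 0] with x hx using mul_nonneg hx (gaussTail_nonneg x)
  · filter_upwards [eventually_ge_atTop 0] with x hx
    have := mul_le_mul_of_nonneg_left (hC x hx) hx
    linarith

theorem integral_gaussTail : ∫ x in Ioi 0, gaussTail x = gauss 0 := by
  have := integral_Ioi_of_hasDerivAt_of_tendsto' (a := 0)
    (f := fun x => x * gaussTail x - gauss x) (f' := gaussTail) (m := 0 - 0) (fun x _ => by
      refine (((hasDerivAt_id x).mul (hasDerivAt_gaussTail x)).sub
        (hasDerivAt_gauss x)).congr_deriv ?_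
      simp) integrableOn_gaussTail (tendsto_id_mul_gaussTail_atTop.sub tendsto_gauss_atTop)
  rw [this]; ring

theorem gauss_sq_eq (z : ℝ) : gauss z ^ 2 = (2 * Real.pi)⁻¹ * Real.exp (-1 * z ^ 2) := by
  rw [gauss_eq, mul_pow, inv_pow, Real.sq_sqrt (by positivity), ← Real.exp_nat_mul]
  congr 2
  push_cast; ring

theorem integrable_gauss_sq : Integrable fun z => gauss z ^ 2 := by
  simp only [gauss_sq_eq]
  exact (integrable_exp_neg_mul_sq one_pos).const_mul _

theorem integral_gauss_sq : ∫ z, gauss z ^ 2 = (2 * √Real.pi)⁻¹ := by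
  simp only [gauss_sq_eq]
  rw [integral_const_mul, _root_.integral_gaussian, div_one]
  have : √Real.pi * √Real.pi = Real.pi := Real.mul_self_sqrt Real.pi_pos.le
  field_simp
  linarith

theorem integral_Ioi_gauss_sq : ∫ z in Ioi 0, gauss z ^ 2 = (4 * √Real.pi)⁻¹ := by
  have h := integral_comp_abs (f := fun z => gauss z ^ 2)
  have e : ∀ z, gauss |z| = gauss z := fun z => by
    rcases abs_choice z with h | h <;> simp [h, gauss_neg]
  simp only [e, integral_gauss_sq] at h
  have e : (4 * √Real.pi)⁻¹ = (2 * √Real.pi)⁻¹ / 2 := by field_simp; norm_num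
  rw [e, h]
  ring

theorem integrableOn_gaussTail_sq : IntegrableOn (fun x => gaussTail x ^ 2) (Ioi 0) := by
  refine Integrable.mono integrableOn_gaussTail
    (continuous_gaussTail.pow 2).aestronglyMeasurable (ae_of_all _ fun x => ?_)
  rw [norm_pow, Real.norm_of_nonneg (gaussTail_nonneg x)]
  exact pow_le_of_le_one (gaussTail_nonneg x) (gaussTail_le_one x) two_ne_zero

theorem tendsto_gaussTail_atTop : Tendsto gaussTail atTop (𝓝 0) := by
  obtain ⟨C, hC⟩ := exists_gaussTail_le
  have h : Tendsto (fun x => C * gauss x) atTop (𝓝 0) := by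
    simpa using tendsto_gauss_atTop.const_mul C
  refine squeeze_zero' (Eventually.of_forall gaussTail_nonneg) ?_ h
  filter_upwards [eventually_ge_atTop 0] with x hx using hC x hx

/-- The function `x · gaussTail² - 2 · gauss · gaussTail` has derivative `gaussTail² + 2 · gauss²`,
and the integral of `gauss²` is explicit. -/
theorem integral_gaussTail_sq :
    ∫ x in Ioi 0, gaussTail x ^ 2 = gauss 0 - (2 * √Real.pi)⁻¹ := by
  have i2 : IntegrableOn (fun x => 2 * gauss x ^ 2) (Ioi 0) :=
    (integrable_gauss_sq.const_mul 2).integrableOn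
  have h := integral_Ioi_of_hasDerivAt_of_tendsto' (a := 0)
    (f := fun x => x * gaussTail x * gaussTail x - 2 * (gauss x * gaussTail x))
    (f' := fun x => gaussTail x ^ 2 + 2 * gauss x ^ 2) (m := 0 * 0 - 2 * (0 * 0)) (fun x _ => by
      refine ((((hasDerivAt_id x).mul (hasDerivAt_gaussTail x)).mul
        (hasDerivAt_gaussTail x)).sub (((hasDerivAt_gauss x).mul
          (hasDerivAt_gaussTail x)).const_mul 2)).congr_deriv ?_
      simp only [Pi.mul_apply, id_eq]
      ring) (integrableOn_gaussTail_sq.add i2)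
    ((tendsto_id_mul_gaussTail_atTop.mul tendsto_gaussTail_atTop).sub
      ((tendsto_gauss_atTop.mul tendsto_gaussTail_atTop).const_mul 2))
  rw [integral_add integrableOn_gaussTail_sq i2, integral_const_mul, integral_Ioi_gauss_sq,
    gaussTail_zero] at h
  have e : (4 * √Real.pi)⁻¹ = (2 * √Real.pi)⁻¹ / 2 := by field_simp; norm_num
  rw [e] at h
  linarith

/-! ### The heat flow of the Heaviside function. -/

/-- The Heaviside function. -/
def heaviside : ℝ → ℝ := (Ici (0 : ℝ)).indicator fun _ => 1

theorem measurable_heaviside : Measurable heaviside := measurable_const.indicator measurableSet_Ici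

theorem abs_heaviside_le (u : ℝ) : |heaviside u| ≤ 1 := by
  unfold heaviside
  by_cases h : u ∈ Ici (0 : ℝ) <;> simp only [h, indicator_of_mem, indicator_of_notMem,
    not_false_eq_true, abs_one, abs_zero, le_refl, zero_le_one]

theorem heat_heaviside {t : ℝ} (ht : 0 < t) (u : ℝ) :
    heat t heaviside u = 1 - gaussTail (u / √t) := by
  have hs := Real.sqrt_pos.2 ht
  have e : ∀ z, gauss z * heaviside (u + √t * z) = (Ici (-(u / √t))).indicator gauss z := by
    intro z
    have : u + √t * z ∈ Ici (0 : ℝ) ↔ z ∈ Ici (-(u / √t)) := by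
      rw [mem_Ici, mem_Ici, neg_le_iff_add_nonneg, ← mul_le_mul_iff_right₀ hs]
      field_simp
      rw [mul_zero, add_comm]
    by_cases h : z ∈ Ici (-(u / √t))
    · rw [heaviside, indicator_of_mem h, indicator_of_mem (this.2 h), mul_one]
    · rw [heaviside, indicator_of_notMem h, indicator_of_notMem (mt this.1 h), mul_zero]
  rw [← gaussTail_neg, heat, integral_gaussian]
  simp only [e]
  rw [integral_indicator measurableSet_Ici, integral_Ici_eq_integral_Ioi]
  rfl

theorem heat_heaviside_sub_of_nonneg {t : ℝ} (ht : 0 < t) {u : ℝ} (hu : 0 ≤ u) :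
    heat t heaviside u - heaviside u = -gaussTail (u / √t) := by
  rw [heat_heaviside ht, heaviside, indicator_of_mem (show u ∈ Ici (0 : ℝ) from hu)]
  ring

theorem sq_heat_heaviside_sub {t : ℝ} (ht : 0 < t) (u : ℝ) :
    (heat t heaviside u - heaviside u) ^ 2 = gaussTail (|u| / √t) ^ 2 := by
  rcases le_or_gt 0 u with hu | hu
  · rw [heat_heaviside_sub_of_nonneg ht hu, abs_of_nonneg hu, neg_sq]
  · rw [heat_heaviside ht, heaviside, indicator_of_notMem (by simpa using hu), ← gaussTail_neg,
      abs_of_neg hu, neg_div, sub_zero]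

/-- The difference is, up to sign, the Gaussian tail at `|u| / √t`, so symmetry and scaling reduce
the integral to `integral_gaussTail_sq`. -/
theorem integral_sq_heat_heaviside_sub {t : ℝ} (ht : 0 < t) :
    ∫ u, (heat t heaviside u - heaviside u) ^ 2 = √(2 * t / Real.pi) - √(t / Real.pi) := by
  have hs := Real.sqrt_pos.2 ht
  simp only [sq_heat_heaviside_sub ht]
  rw [integral_comp_abs (f := fun u => gaussTail (u / √t) ^ 2)]
  have := integral_comp_mul_left_Ioi (fun u => gaussTail u ^ 2) 0 (inv_pos.2 hs)
  simp only [← div_eq_inv_mul, mul_zero, inv_inv, smul_eq_mul] at this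
  rw [this, integral_gaussTail_sq, gauss_zero, Real.sqrt_div (by positivity),
    Real.sqrt_div (by positivity), Real.sqrt_mul zero_le_two, Real.sqrt_mul zero_le_two]
  have h2 : √2 * √2 = 2 := Real.mul_self_sqrt zero_le_two
  have hp := Real.sqrt_pos.2 Real.pi_pos
  field_simp
  linear_combination (-1 : ℝ) * h2

theorem integrable_sq_heat_heaviside_sub {t : ℝ} (ht : 0 < t) :
    Integrable fun u => (heat t heaviside u - heaviside u) ^ 2 := by
  have hs := Real.sqrt_pos.2 ht
  simp only [sq_heat_heaviside_sub ht]
  obtain ⟨C, hC⟩ := exists_gaussTail_le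
  refine ((integrable_gauss.comp_div hs.ne').const_mul C).mono'
    (Continuous.aestronglyMeasurable ?_) (ae_of_all _ fun u => ?_)
  · exact (continuous_gaussTail.comp (by fun_prop)).pow 2
  · have h0 : 0 ≤ |u| / √t := by positivity
    have e : gauss (|u| / √t) = gauss (u / √t) := by
      rcases abs_choice u with h | h <;> simp [h, gauss_neg, neg_div]
    rw [← e, norm_pow, Real.norm_of_nonneg (gaussTail_nonneg _)]
    exact (pow_le_of_le_one (gaussTail_nonneg _) (gaussTail_le_one _) two_ne_zero).trans (hC _ h0)

theorem measurable_heat_heaviside : Measurable fun p : ℝ × ℝ => heat p.1 heaviside p.2 := by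
  have h : StronglyMeasurable fun q : (ℝ × ℝ) × ℝ => heaviside (q.1.2 + √q.1.1 * q.2) :=
    (measurable_heaviside.comp (by fun_prop)).stronglyMeasurable
  exact (h.integral_prod_right' (ν := gaussianReal 0 1)).measurable

theorem measurable_heat_heaviside_right (t : ℝ) : Measurable (heat t heaviside) :=
  measurable_heat_heaviside.comp (by fun_prop : Measurable fun u : ℝ => (t, u))

/-- Testing the heat flow of the Heaviside function amounts to letting the heat flow act on the
primitive of the test function. -/
theorem integral_heat_heaviside_mul {h : ℝ → ℝ} (hh : Integrable h) (t : ℝ) :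
    ∫ u, heat t heaviside u * h u = heat t (fun x => ∫ u in Ioi (-x), h u) 0 := by
  have hi : Integrable (fun p : ℝ × ℝ => heaviside (p.2 + √t * p.1) * h p.2)
      ((gaussianReal 0 1).prod volume) := by
    refine Integrable.bdd_mul (c := 1) (hh.comp_snd (gaussianReal 0 1)) ?_
      (ae_of_all _ fun p => abs_heaviside_le _)
    exact (measurable_heaviside.comp (by fun_prop)).aestronglyMeasurable
  have h2 := integral_integral_swap (f := fun z u => heaviside (u + √t * z) * h u) hi
  have e1 : ∀ u, ∫ z, heaviside (u + √t * z) * h u ∂gaussianReal 0 1 = heat t heaviside u * h u :=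
    fun u => integral_mul_const _ _
  have e2 : ∀ z, ∫ u, heaviside (u + √t * z) * h u = ∫ u in Ioi (-(0 + √t * z)), h u := by
    intro z
    rw [← integral_Ici_eq_integral_Ioi, ← integral_indicator measurableSet_Ici]
    congr 1; ext u
    by_cases hu : 0 ≤ u + √t * z
    · rw [heaviside, indicator_of_mem (show u + √t * z ∈ Ici (0 : ℝ) from hu), one_mul,
        indicator_of_mem]
      rw [mem_Ici]; linarith
    · rw [heaviside, indicator_of_notMem (show u + √t * z ∉ Ici (0 : ℝ) from hu), zero_mul,
        indicator_of_notMem]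
      rw [mem_Ici]; linarith
  simp only [e1, e2] at h2
  rw [← h2]
  rfl

theorem continuous_tail_integral {h : ℝ → ℝ} (hh : Integrable h) :
    Continuous fun x => ∫ u in Ioi (-x), h u := by
  have e : (fun x => ∫ u in Ioi (-x), h u) =
      fun x => (∫ u in Ioi 0, h u) - ∫ u in (0 : ℝ)..-x, h u := by
    ext x
    have := intervalIntegral.integral_Ioi_sub_Ioi' (a := (0 : ℝ)) (b := -x) (μ := volume)
      hh.integrableOn hh.integrableOn
    linarith
  rw [e]
  exact continuous_const.sub ((intervalIntegral.continuous_primitive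
    (fun a b => hh.intervalIntegrable) 0).comp continuous_neg)

theorem abs_tail_integral_le {h : ℝ → ℝ} (hh : Integrable h) (x : ℝ) :
    |∫ u in Ioi (-x), h u| ≤ ∫ u, |h u| :=
  abs_integral_le_integral_abs.trans
    (setIntegral_le_integral hh.abs (ae_of_all _ fun _ => abs_nonneg _))

/-! ### The optimal path: regularity and half-line gain. -/

/-- The density of the optimal path. -/
def optDensity (T c s u : ℝ) : ℝ := c * (heat (T - s) heaviside u - heat s heaviside u)

theorem measurable_optDensity (T c s : ℝ) : Measurable (optDensity T c s) :=
  measurable_const.mul ((measurable_heat_heaviside_right _).sub (measurable_heat_heaviside_right _))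

theorem abs_optDensity_le (T c s u : ℝ) : |optDensity T c s u| ≤ |c| * 2 := by
  rw [optDensity, abs_mul]
  refine mul_le_mul_of_nonneg_left ((abs_sub _ _).trans ?_) (abs_nonneg _)
  linarith [abs_heat_le abs_heaviside_le (T - s) u, abs_heat_le abs_heaviside_le s u]

theorem locallyIntegrable_optDensity (T c s : ℝ) : LocallyIntegrable (optDensity T c s) :=
  (locallyIntegrable_const (|c| * 2)).mono (measurable_optDensity T c s).aestronglyMeasurable
    (ae_of_all _ fun u => (abs_optDensity_le T c s u).trans (le_abs_self _))

theorem integrable_optDensity_mul (T c s : ℝ) {h : ℝ → ℝ} (hh : Integrable h) :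
    Integrable fun u => optDensity T c s u * h u :=
  hh.bdd_mul (measurable_optDensity T c s).aestronglyMeasurable
    (ae_of_all _ (abs_optDensity_le T c s))

/-- This moves the heat flow from the discontinuous Heaviside function onto a continuous bounded
primitive, so that regularity in `s` comes from the heat flow of that primitive at the origin. -/
theorem integral_optDensity_mul (T c s : ℝ) {h : ℝ → ℝ} (hh : Integrable h) :
    ∫ u, optDensity T c s u * h u = c * (heat (T - s) (fun x => ∫ u in Ioi (-x), h u) 0 -
      heat s (fun x => ∫ u in Ioi (-x), h u) 0) := by
  have hi : ∀ t, Integrable fun u => heat t heaviside u * h u := fun t =>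
    hh.bdd_mul (measurable_heat_heaviside_right t).aestronglyMeasurable
      (ae_of_all _ (abs_heat_le abs_heaviside_le t))
  rw [← integral_heat_heaviside_mul hh, ← integral_heat_heaviside_mul hh,
    ← integral_sub (hi _) (hi _), ← integral_const_mul]
  congr 1; ext u
  rw [optDensity]; ring

/-- The tempered distribution given by a bounded function. -/
def TDist.ofBounded (f : ℝ → ℝ) (hf : Measurable f) (B : ℝ) (hB : ∀ u, |f u| ≤ B) : TDist :=
  ContinuousLinearMap.toPointwiseConvergenceCLM ℝ (RingHom.id ℝ) 𝓢(ℝ, ℝ) ℝ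
    (SchwartzMap.mkCLMtoNormedSpace (𝕜 := ℝ) (fun φ => ∫ u, f u * φ u)
      (fun φ ψ => by
        rw [← integral_add (φ.integrable.bdd_mul hf.aestronglyMeasurable (ae_of_all _ hB))
          (ψ.integrable.bdd_mul hf.aestronglyMeasurable (ae_of_all _ hB))]
        congr 1; ext u
        rw [add_apply, mul_add])
      (fun a φ => by
        rw [RingHom.id_apply, smul_eq_mul, ← integral_const_mul]
        congr 1; ext u
        rw [smul_apply, smul_eq_mul]; ring)
      (by
        have B0 : 0 ≤ B := (abs_nonneg _).trans (hB 0)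
        refine ⟨{(0, 0), (2, 0)}, B * ((∫ u : ℝ, (1 + u ^ 2)⁻¹) * 2), ?_, fun φ => ?_⟩
        · have : 0 ≤ ∫ u : ℝ, (1 + u ^ 2)⁻¹ := integral_nonneg fun u => by positivity
          positivity
        set S := ({(0, 0), (2, 0)} : Finset (ℕ × ℕ)).sup (schwartzSeminormFamily ℝ ℝ ℝ) φ
        have h0 : ∀ m ∈ ({(0, 0), (2, 0)} : Finset (ℕ × ℕ)),
            schwartzSeminormFamily ℝ ℝ ℝ m φ ≤ S := fun m hm =>
          Seminorm.le_def.1 (Finset.le_sup (f := schwartzSeminormFamily ℝ ℝ ℝ) hm) φ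
        have hb : ∀ u, |φ u| ≤ (1 + u ^ 2)⁻¹ * (2 * S) := by
          intro u
          rw [← div_eq_inv_mul, le_div_iff₀ (by positivity)]
          have h1 := (SchwartzMap.norm_pow_mul_le_seminorm ℝ φ 0 u).trans (h0 (0, 0) (by simp))
          have h2 := (SchwartzMap.norm_pow_mul_le_seminorm ℝ φ 2 u).trans (h0 (2, 0) (by simp))
          simp only [Real.norm_eq_abs, sq_abs, pow_zero, one_mul] at h1 h2
          linarith
        have h3 : ∫ u : ℝ, B * ((1 + u ^ 2)⁻¹ * (2 * S)) =
            B * ((∫ u : ℝ, (1 + u ^ 2)⁻¹) * 2) * S := by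
          rw [integral_const_mul, integral_mul_const]; ring
        rw [← h3]
        refine norm_integral_le_of_norm_le
          ((integrable_inv_one_add_sq.mul_const _).const_mul B) (ae_of_all _ fun u => ?_)
        rw [norm_mul]
        exact mul_le_mul (hB u) (hb u) (norm_nonneg _) B0))

/-- If `g` is not a Schwartz function, the pairing uses some chosen density, which agrees with `f`
almost everywhere by the fundamental lemma of the calculus of variations. -/
theorem pairing_eq_integral {ν : TDist} {f g : ℝ → ℝ} (hf : LocallyIntegrable f)
    (hν : ∀ φ : 𝓢(ℝ, ℝ), ν φ = ∫ u, f u * φ u) : pairing ν g = ∫ u, f u * g u := by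
  by_cases h : ∃ φ : 𝓢(ℝ, ℝ), ⇑φ = g
  · obtain ⟨φ, rfl⟩ := h
    rw [pairing_schwartz, hν]
  · have hd : ∃ f : ℝ → ℝ, IsDensity ν f := ⟨f, hf, fun φ _ => hν φ⟩
    rw [pairing, dif_neg h, dif_pos hd]
    have h1 := hd.choose_spec
    have h2 : ∀ᵐ u, hd.choose u = f u := by
      refine ae_eq_of_integral_contDiff_smul_eq h1.1 hf fun φ hφ hc => ?_
      have h3 := h1.2 (hc.toSchwartzMap hφ) hc
      rw [hν] at h3
      simp only [smul_eq_mul, mul_comm (φ _)]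
      exact h3.symm
    refine integral_congr_ae ?_
    filter_upwards [h2] with u hu
    rw [hu]

/-- The optimal path. -/
def optPath (T c s : ℝ) : TDist :=
  TDist.ofBounded (optDensity T c s) (measurable_optDensity T c s) _ (abs_optDensity_le T c s)

theorem optPath_apply (T c s : ℝ) (φ : 𝓢(ℝ, ℝ)) :
    optPath T c s φ = ∫ u, optDensity T c s u * φ u := rfl

theorem pairing_optPath (T c s : ℝ) (g : ℝ → ℝ) :
    pairing (optPath T c s) g = ∫ u, optDensity T c s u * g u :=
  pairing_eq_integral (locallyIntegrable_optDensity T c s) (optPath_apply T c s)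

theorem isDensity_optPath (T c s : ℝ) : IsDensity (optPath T c s) (optDensity T c s) :=
  ⟨locallyIntegrable_optDensity T c s, fun φ _ => optPath_apply T c s φ⟩

theorem continuous_optPath (T c : ℝ) : Continuous (optPath T c) := by
  refine PointwiseConvergenceCLM.continuous_of_continuous_eval fun φ => ?_
  simp only [optPath_apply, integral_optDensity_mul T c _ φ.integrable]
  have hc := continuous_tail_integral φ.integrable
  have hb := abs_tail_integral_le φ.integrable
  have h1 : ∀ t : ℝ → ℝ, Continuous t →
      Continuous fun s => heat (t s) (fun x => ∫ u in Ioi (-x), φ u) 0 := fun t ht =>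
    continuous_heat (F := fun _ x => ∫ u in Ioi (-x), φ u) ht continuous_const
      (hc.comp continuous_snd) fun _ => hb
  exact continuous_const.mul ((h1 _ (by fun_prop)).sub (h1 _ continuous_id))

theorem isCadlag_optPath (T c : ℝ) : IsCadlag T (optPath T c) :=
  ⟨fun t _ => ((continuous_optPath T c).tendsto t).mono_left nhdsWithin_le_nhds,
    fun t _ => ⟨optPath T c t, ((continuous_optPath T c).tendsto t).mono_left nhdsWithin_le_nhds⟩⟩

theorem optDensity_zero (T c u : ℝ) :
    optDensity T c 0 u = c * (heat T heaviside u - heaviside u) := by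
  rw [optDensity, sub_zero, heat_of_nonpos le_rfl]

theorem optDensity_terminal (T c u : ℝ) :
    optDensity T c T u = -(c * (heat T heaviside u - heaviside u)) := by
  rw [optDensity, sub_self, heat_of_nonpos le_rfl]; ring

theorem tendsto_cutoff {u : ℝ} (hu : 0 ≤ u) : Tendsto (fun n : ℕ => cutoff n u) atTop (𝓝 1) := by
  simp only [cutoff, indicator_of_mem (show u ∈ Ici (0 : ℝ) from hu)]
  have h := ((tendsto_const_div_atTop_nhds_zero_nat u).const_sub 1).max
    (tendsto_const_nhds (x := (0 : ℝ)))
  simpa using h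

/-- The terminal density is minus the initial one, which on the half line is `-c` times the Gaussian
tail at `u / √T`. The gain is thus `2c√T` times the integral of the tail. -/
theorem halfLineGain_optPath {T : ℝ} (hT : 0 < T) (c : ℝ) :
    HalfLineGain (optPath T c T) (optPath T c 0) (c * √(2 * T / Real.pi)) := by
  refine ⟨_, _, isDensity_optPath T c T, isDensity_optPath T c 0, ?_⟩
  have hs := Real.sqrt_pos.2 hT
  have e0 : ∀ n, ∫ u, optDensity T c 0 u * cutoff n u =
      -(c * ∫ u in Ioi 0, gaussTail (u / √T) * cutoff n u) := by
    intro n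
    rw [← integral_Ici_eq_integral_Ioi, ← integral_indicator measurableSet_Ici,
      ← integral_const_mul, ← integral_neg]
    congr 1; ext u
    by_cases hu : 0 ≤ u
    · rw [optDensity_zero, heat_heaviside_sub_of_nonneg hT hu,
        indicator_of_mem (show u ∈ Ici (0 : ℝ) from hu)]
      ring
    · rw [cutoff_of_neg n (not_le.1 hu), indicator_of_notMem (show u ∉ Ici (0 : ℝ) from hu)]
      simp
  have eT : ∀ n, ∫ u, optDensity T c T u * cutoff n u =
      -∫ u, optDensity T c 0 u * cutoff n u := by
    intro n
    rw [← integral_neg]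
    congr 1; ext u
    rw [optDensity_terminal, optDensity_zero]; ring
  simp only [eT, e0]
  have hint : IntegrableOn (fun u => gaussTail (u / √T)) (Ioi 0) := by
    have := (integrableOn_Ioi_comp_mul_left_iff gaussTail 0 (inv_pos.2 hs)).2
      (by simpa using integrableOn_gaussTail)
    simpa only [← div_eq_inv_mul] using this
  have hval : ∫ u in Ioi 0, gaussTail (u / √T) = √T * gauss 0 := by
    have := integral_comp_mul_left_Ioi gaussTail 0 (inv_pos.2 hs)
    simp only [← div_eq_inv_mul, mul_zero, inv_inv, smul_eq_mul] at this
    rw [this, integral_gaussTail]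
  have hlim : Tendsto (fun n : ℕ => ∫ u in Ioi 0, gaussTail (u / √T) * cutoff n u) atTop
      (𝓝 (√T * gauss 0)) := by
    rw [← hval]
    refine tendsto_integral_of_dominated_convergence (fun u => gaussTail (u / √T)) (fun n => ?_)
      hint (fun n => ae_of_all _ fun u => ?_) ?_
    · exact (continuous_gaussTail.comp (by fun_prop)).aestronglyMeasurable.mul
        (measurable_cutoff n).aestronglyMeasurable
    · rw [norm_mul, Real.norm_of_nonneg (gaussTail_nonneg _),
        Real.norm_of_nonneg (cutoff_nonneg n u)]
      exact mul_le_of_le_one_right (gaussTail_nonneg _) (cutoff_le_one n u)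
    · filter_upwards [ae_restrict_mem measurableSet_Ioi] with u hu
      simpa using (tendsto_cutoff (le_of_lt hu)).const_mul (gaussTail (u / √T))
  have hK : √(2 * T / Real.pi) = 2 * (√T * gauss 0) := by
    rw [gauss_zero, Real.sqrt_div (by positivity), Real.sqrt_mul zero_le_two,
      Real.sqrt_mul zero_le_two]
    have h2 : √2 * √2 = 2 := Real.mul_self_sqrt zero_le_two
    have hp := Real.sqrt_pos.2 Real.pi_pos
    field_simp
    linear_combination h2
  have h := ((hlim.const_mul c).neg.neg).sub (hlim.const_mul c).neg
  rw [hK]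
  convert h using 2
  ring

/-! ### Static and dynamical costs of the optimal path. -/

/-- The initial density is `σ` times `l(P_T H - H)`. Completing the square pointwise bounds the
functional by its value at `φ = l(P_T H - H)`. -/
theorem Qzero_optPath_le {ρ T : ℝ} (hρ : 0 < ρ * (1 - ρ)) (hT : 0 < T) (l : ℝ) :
    Qzero ρ (optPath T (ρ * (1 - ρ) * l) 0) ≤
      ((ρ * (1 - ρ) * l ^ 2 / 2 * (√(2 * T / Real.pi) - √(T / Real.pi)) : ℝ) : EReal) := by
  set σ := ρ * (1 - ρ) with hσ
  refine iSup₂_le fun φ hφ => ?_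
  rw [EReal.coe_le_coe_iff, pairing_optPath, ← hσ, ← integral_sq_heat_heaviside_sub hT]
  have i1 : Integrable fun u => φ u ^ 2 :=
    (hφ.1.pow 2).integrable_of_hasCompactSupport (by
      simpa only [sq] using! hφ.2.mul_left (f := φ))
  have i2 := integrable_sq_heat_heaviside_sub hT
  have i3 := integrable_optDensity_mul T (σ * l) 0 (hφ.1.integrable_of_hasCompactSupport hφ.2)
  rw [sub_le_iff_le_add', ← integral_const_mul, ← integral_const_mul,
    ← integral_add (i1.const_mul _) (i2.const_mul _)]
  refine integral_mono i3 ((i1.const_mul _).add (i2.const_mul _)) fun u => ?_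
  simp only [optDensity_zero]
  nlinarith [mul_nonneg hρ.le (sq_nonneg (φ u - l * (heat T heaviside u - heaviside u)))]

theorem heat_add_const_mul {f g : ℝ → ℝ} {B B' : ℝ} (hf : Continuous f) (hB : ∀ x, |f x| ≤ B)
    (hg : Continuous g) (hB' : ∀ x, |g x| ≤ B') (a t u : ℝ) :
    heat t (fun x => f x + a * g x) u = heat t f u + a * heat t g u := by
  rw [heat, integral_add (integrable_heat hf hB t u) ((integrable_heat hg hB' t u).const_mul a),
    integral_const_mul]
  rfl

/-- A test function and its derivatives vanish outside of a square. -/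
theorem IsTest.exists_vanish {G : ℝ → ℝ → ℝ} (hG : IsTest G) :
    ∃ M > 0, ∀ s u, M ≤ |s| ∨ M ≤ |u| → G s u = 0 ∧ deriv (fun r => G r u) s = 0 ∧
      deriv (G s) u = 0 ∧ iteratedDeriv 2 (G s) u = 0 := by
  obtain ⟨M₀, hM₀⟩ := hG.compact.isCompact.isBounded.exists_norm_le
  have h0 : ∀ s u, M₀ < |s| ∨ M₀ < |u| → G s u = 0 := by
    intro s u h
    by_contra hne
    have h1 := hM₀ (s, u) (subset_tsupport (fun p : ℝ × ℝ => G p.1 p.2) hne)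
    rw [Prod.norm_def, max_le_iff] at h1
    simp only [Real.norm_eq_abs] at h1
    rcases h with h | h <;> linarith [h1.1, h1.2]
  have hop : ∀ v : ℝ, M₀ < |v| → ∀ᶠ w in 𝓝 v, M₀ < |w| := fun v hv =>
    (isOpen_lt continuous_const continuous_abs).mem_nhds hv
  refine ⟨|M₀| + 1, by positivity, fun s u h => ?_⟩
  have h' : M₀ < |s| ∨ M₀ < |u| := by
    have := le_abs_self M₀
    rcases h with h | h
    · left; linarith
    · right; linarith
  refine ⟨h0 s u h', ?_⟩
  rcases h' with h | h
  · have e1 : (fun r => G r u) =ᶠ[𝓝 s] fun _ => 0 := (hop s h).mono fun r hr => h0 r u (Or.inl hr)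
    have e2 : G s = fun _ => 0 := funext fun v => h0 s v (Or.inl h)
    rw [e1.deriv_eq, e2]
    simp
  · have e1 : (fun r => G r u) = fun _ => 0 := funext fun r => h0 r u (Or.inr h)
    have e2 : G s =ᶠ[𝓝 u] fun _ => 0 := (hop u h).mono fun r hr => h0 s r (Or.inr hr)
    rw [e1, e2.deriv_eq, e2.iteratedDeriv_eq]
    simp

theorem exists_bound_of_vanish {K : ℝ → ℝ → ℝ} {M : ℝ} (hK : Continuous fun p : ℝ × ℝ => K p.1 p.2)
    (h0 : ∀ s u, M ≤ |s| ∨ M ≤ |u| → K s u = 0) : ∃ B, ∀ s u, |K s u| ≤ B := by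
  have hc : HasCompactSupport fun p : ℝ × ℝ => K p.1 p.2 := by
    refine HasCompactSupport.intro ((isCompact_Icc (a := -M) (b := M)).prod
      (isCompact_Icc (a := -M) (b := M))) fun p hp => h0 _ _ ?_
    rw [mem_prod, not_and_or, mem_Icc, ← abs_le, mem_Icc, ← abs_le, not_le, not_le] at hp
    exact hp.imp le_of_lt le_of_lt
  obtain ⟨B, hB⟩ := hc.exists_bound_of_continuous hK
  exact ⟨B, fun s u => hB (s, u)⟩

theorem hasCompactSupport_of_vanish {k : ℝ → ℝ} {M : ℝ} (h0 : ∀ u, M ≤ |u| → k u = 0) :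
    HasCompactSupport k :=
  HasCompactSupport.intro (isCompact_Icc (a := -M) (b := M)) fun u hu => h0 u (by
    rw [mem_Icc, ← abs_le, not_le] at hu
    exact hu.le)

theorem tail_integral_eq_intervalIntegral {k : ℝ → ℝ} {M : ℝ} (hk : Continuous k)
    (h0 : ∀ u, M ≤ |u| → k u = 0) (x : ℝ) : ∫ u in Ioi (-x), k u = ∫ u in (-x)..M, k u := by
  have hi := hk.integrable_of_hasCompactSupport (hasCompactSupport_of_vanish h0) (μ := volume)
  have hz : ∫ u in Ioi M, k u = 0 := setIntegral_eq_zero_of_forall_eq_zero fun u hu =>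
    h0 u ((le_of_lt (mem_Ioi.1 hu)).trans (le_abs_self u))
  rw [← intervalIntegral.integral_interval_add_Ioi (b := M) hi.integrableOn hi.integrableOn, hz,
    add_zero]

theorem continuous_tail_integral_param {K : ℝ → ℝ → ℝ} {M : ℝ}
    (hK : Continuous fun p : ℝ × ℝ => K p.1 p.2) (h0 : ∀ s u, M ≤ |u| → K s u = 0) :
    Continuous fun p : ℝ × ℝ => ∫ u in Ioi (-p.2), K p.1 u := by
  have e : ∀ p : ℝ × ℝ, ∫ u in Ioi (-p.2), K p.1 u = -∫ u in M..(-p.2), K p.1 u := fun p => by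
    have hk : Continuous (K p.1) := hK.comp (by fun_prop : Continuous fun u : ℝ => (p.1, u))
    rw [tail_integral_eq_intervalIntegral hk (h0 p.1), intervalIntegral.integral_symm]
  simp only [e]
  refine (intervalIntegral.continuous_parametric_intervalIntegral_of_continuous
    (f := fun (p : ℝ × ℝ) u => K p.1 u) (μ := volume) ?_ (by fun_prop)).neg
  exact hK.comp (by fun_prop : Continuous fun q : (ℝ × ℝ) × ℝ => (q.1.1, q.2))

theorem hasDerivAt_tail_integral {k : ℝ → ℝ} (hk : Continuous k) (hi : Integrable k) (x : ℝ) :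
    HasDerivAt (fun x => ∫ u in Ioi (-x), k u) (k (-x)) x := by
  have e : (fun x => ∫ u in Ioi (-x), k u) =
      fun x => (∫ u in Ioi 0, k u) - ∫ u in (0 : ℝ)..-x, k u := by
    ext x
    have := intervalIntegral.integral_Ioi_sub_Ioi' (a := (0 : ℝ)) (b := -x) (μ := volume)
      hi.integrableOn hi.integrableOn
    linarith
  rw [e]
  have h1 : HasDerivAt (fun y => ∫ u in (0 : ℝ)..y, k u) (k (-x)) (-x) :=
    intervalIntegral.integral_hasDerivAt_right hi.intervalIntegrable
      (hk.stronglyMeasurableAtFilter _ _) hk.continuousAt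
  have h2 := (h1.comp x (hasDerivAt_neg x)).const_sub (∫ u in Ioi 0, k u)
  exact h2.congr_deriv (by ring)

theorem hasDerivAt_tail_integral_param {K K' : ℝ → ℝ → ℝ} {M : ℝ}
    (hK : Continuous fun p : ℝ × ℝ => K p.1 p.2) (hK' : Continuous fun p : ℝ × ℝ => K' p.1 p.2)
    (hd : ∀ s u, HasDerivAt (fun r => K r u) (K' s u) s) (h0 : ∀ s u, M ≤ |u| → K s u = 0)
    (h0' : ∀ s u, M ≤ |u| → K' s u = 0) {B : ℝ} (hB : ∀ s u, |K' s u| ≤ B) (s x : ℝ) :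
    HasDerivAt (fun r => ∫ u in Ioi (-x), K r u) (∫ u in Ioi (-x), K' s u) s := by
  have c : ∀ {L : ℝ → ℝ → ℝ}, (Continuous fun p : ℝ × ℝ => L p.1 p.2) → ∀ r, Continuous (L r) :=
    fun hL r => hL.comp (by fun_prop : Continuous fun u : ℝ => (r, u))
  simp only [fun r => tail_integral_eq_intervalIntegral (c hK r) (h0 r) x,
    tail_integral_eq_intervalIntegral (c hK' s) (h0' s) x]
  exact (intervalIntegral.hasDerivAt_integral_of_dominated_loc_of_deriv_le (μ := volume)
    (F := K) (F' := K') (bound := fun _ => B) (s := univ) univ_mem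
    (Eventually.of_forall fun r => (c hK r).aestronglyMeasurable)
    ((c hK s).intervalIntegrable _ _) (c hK' s).aestronglyMeasurable
    (ae_of_all _ fun u _ r _ => hB r u) intervalIntegrable_const
    (ae_of_all _ fun u _ r _ => hd r u)).2

/-- The weak form of the equation satisfied by the optimal path. -/
theorem IsTest.linPart_optPath {G : ℝ → ℝ → ℝ} (hG : IsTest G) {T : ℝ} (hT : 0 ≤ T) (c : ℝ) :
    linPart T (optPath T c) G =
      c * ∫ s in (0 : ℝ)..T, heat (T - s) (fun x => deriv (G s) (-x)) 0 := by
  obtain ⟨M, hM, hv⟩ := hG.exists_vanish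
  set Gs : ℝ → ℝ → ℝ := fun s u => deriv (fun r => G r u) s with hGs
  set Gu : ℝ → ℝ → ℝ := fun s u => deriv (G s) u with hGu
  set Guu : ℝ → ℝ → ℝ := fun s u => iteratedDeriv 2 (G s) u with hGuu
  obtain ⟨B₀, hB₀⟩ := exists_bound_of_vanish hG.cont fun s u h => (hv s u h).1
  obtain ⟨B₁, hB₁⟩ := exists_bound_of_vanish (K := Gs) hG.cont_time fun s u h => (hv s u h).2.1
  obtain ⟨B₂, hB₂⟩ := exists_bound_of_vanish (K := Gu) hG.cont_space fun s u h => (hv s u h).2.2.1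
  have dGs : ∀ s u, HasDerivAt (fun r => G r u) (Gs s u) s := fun s u =>
    (hG.diff_time u s).hasDerivAt
  have dGu : ∀ s u, HasDerivAt (G s) (Gu s u) u := fun s u =>
    ((hG.diff_space s).differentiable (by norm_num) u).hasDerivAt
  have dGuu : ∀ s u, HasDerivAt (Gu s) (Guu s u) u := fun s u => by
    have h1 : Differentiable ℝ (deriv (G s)) := by
      have := hG.diff_space s
      rw [show (2 : WithTop ℕ∞) = 1 + 1 by norm_num, contDiff_succ_iff_deriv] at this
      exact this.2.2.differentiable (by norm_num)
    have h2 : Guu s u = deriv (deriv (G s)) u := by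
      rw [hGuu]; simp only [iteratedDeriv_succ, iteratedDeriv_zero]
    rw [h2]
    exact (h1 u).hasDerivAt
  have sl : ∀ {L : ℝ → ℝ → ℝ}, (Continuous fun p : ℝ × ℝ => L p.1 p.2) → ∀ r, Continuous (L r) :=
    fun hL r => hL.comp (by fun_prop : Continuous fun u : ℝ => (r, u))
  have int : ∀ {L : ℝ → ℝ → ℝ}, (Continuous fun p : ℝ × ℝ => L p.1 p.2) →
      (∀ s u, M ≤ |u| → L s u = 0) → ∀ r, Integrable (L r) := fun hL h0 r =>
    (sl hL r).integrable_of_hasCompactSupport (hasCompactSupport_of_vanish (h0 r))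
  have v0 : ∀ s u, M ≤ |u| → G s u = 0 := fun s u h => (hv s u (Or.inr h)).1
  have v1 : ∀ s u, M ≤ |u| → Gs s u = 0 := fun s u h => (hv s u (Or.inr h)).2.1
  have v2 : ∀ s u, M ≤ |u| → Gu s u = 0 := fun s u h => (hv s u (Or.inr h)).2.2.1
  have v3 : ∀ s u, M ≤ |u| → Guu s u = 0 := fun s u h => (hv s u (Or.inr h)).2.2.2
  have c0 : Continuous fun p : ℝ × ℝ => G p.1 p.2 := hG.cont
  have c1 : Continuous fun p : ℝ × ℝ => Gs p.1 p.2 := hG.cont_time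
  have c2 : Continuous fun p : ℝ × ℝ => Gu p.1 p.2 := hG.cont_space
  have c3 : Continuous fun p : ℝ × ℝ => Guu p.1 p.2 := hG.cont_space_two
  have tb : ∀ {L : ℝ → ℝ → ℝ} {B : ℝ}, (Continuous fun p : ℝ × ℝ => L p.1 p.2) →
      (∀ s u, M ≤ |u| → L s u = 0) → (∀ s u, |L s u| ≤ B) →
      ∀ s x, |∫ u in Ioi (-x), L s u| ≤ B * (2 * M) := by
    intro L B hL h0 hB s x
    refine (abs_tail_integral_le (int hL h0 s) x).trans ?_
    have e : ∫ u, |L s u| = ∫ u in Icc (-M) M, |L s u| := by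
      refine (setIntegral_eq_integral_of_forall_compl_eq_zero fun u hu => ?_).symm
      rw [mem_Icc, ← abs_le, not_le] at hu
      rw [h0 s u hu.le, abs_zero]
    rw [e]
    have h3 := norm_setIntegral_le_of_norm_le_const (μ := volume) (s := Icc (-M) M) (C := B)
      (f := fun u => |L s u|) (by simp) fun u _ => by simpa using hB s u
    rw [Real.volume_real_Icc_of_le (by linarith)] at h3
    exact (le_abs_self _).trans (h3.trans (le_of_eq (by ring)))
  set Γ : ℝ → ℝ → ℝ := fun s x => ∫ u in Ioi (-x), G s u with hΓ
  set Γs : ℝ → ℝ → ℝ := fun s x => ∫ u in Ioi (-x), Gs s u with hΓs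
  set D : ℝ → ℝ → ℝ := fun s x => Gu s (-x) with hD
  have cΓ : Continuous fun p : ℝ × ℝ => Γ p.1 p.2 := continuous_tail_integral_param c0 v0
  have cΓs : Continuous fun p : ℝ × ℝ => Γs p.1 p.2 := continuous_tail_integral_param c1 v1
  have cD : Continuous fun p : ℝ × ℝ => D p.1 p.2 :=
    c2.comp (by fun_prop : Continuous fun p : ℝ × ℝ => (p.1, -p.2))
  have bΓ := tb c0 v0 hB₀
  have bΓs := tb c1 v1 hB₁
  have bD : ∀ s x, |D s x| ≤ B₂ := fun s x => hB₂ _ _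
  set B := max (max (B₀ * (2 * M)) (B₁ * (2 * M))) (max B₀ B₂) with hBdef
  -- One formula for both halves of the density: `(b, a) = (T, -1)` for the backward flow and `(0,
  -- 1)` for the forward flow.
  have mov : ∀ b a s, 0 < b + a * s → HasDerivAt (fun r => heat (b + a * r) (Γ r) 0)
      (heat (b + a * s) (Γs s) 0 - a / 2 * heat (b + a * s) (D s) 0) s := by
    intro b a s hs
    have h := hasDerivAt_heat_moving (Γ := Γ) (Γs := Γs) (Γx := fun s x => G s (-x))
      (Γxx := fun s x => -D s x) (B := B)
      (fun s x => hasDerivAt_tail_integral_param c0 c1 dGs v0 v1 hB₁ s x)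
      (fun s x => hasDerivAt_tail_integral (sl c0 s) (int c0 v0 s) x)
      (fun s x => ((dGu s (-x)).comp x (hasDerivAt_neg x)).congr_deriv (by simp [hD]))
      cΓ cΓs (c0.comp (by fun_prop : Continuous fun p : ℝ × ℝ => (p.1, -p.2))) cD.neg
      (fun s x => (bΓ s x).trans ((le_max_left _ _).trans (le_max_left _ _)))
      (fun s x => (bΓs s x).trans ((le_max_right _ _).trans (le_max_left _ _)))
      (fun s x => (hB₀ s (-x)).trans ((le_max_left _ _).trans (le_max_right _ _)))
      (fun s x => by
        rw [abs_neg]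
        exact (bD s x).trans ((le_max_right _ _).trans (le_max_right _ _))) b a 0 hs
    refine h.congr_deriv ?_
    have e : (fun x => Γs s x + a / 2 * -D s x) = fun x => Γs s x + (-(a / 2)) * D s x := by
      ext x; ring
    rw [e, heat_add_const_mul (sl cΓs s) (bΓs s) (sl cD s) (bD s)]
    ring
  have ch : ∀ {L : ℝ → ℝ → ℝ} {B : ℝ} (t : ℝ → ℝ), (Continuous fun p : ℝ × ℝ => L p.1 p.2) →
      (∀ s u, |L s u| ≤ B) → Continuous t → Continuous fun s => heat (t s) (L s) 0 :=
    fun t hL hB ht => continuous_heat ht continuous_const hL hB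
  have dA : ∀ s ∈ Ioo 0 T, HasDerivAt (fun r => heat (T - r) (Γ r) 0 - heat r (Γ r) 0)
      ((heat (T - s) (Γs s) 0 + 1 / 2 * heat (T - s) (D s) 0) -
        (heat s (Γs s) 0 - 1 / 2 * heat s (D s) 0)) s := by
    intro s hs
    have h1 := mov T (-1) s (by linarith [hs.2])
    have h2 := mov 0 1 s (by linarith [hs.1])
    have e1 : ∀ r, T + -1 * r = T - r := fun r => by ring
    have e2 : ∀ r : ℝ, 0 + 1 * r = r := fun r => by ring
    simp only [e1] at h1
    simp only [e2] at h2
    exact (h1.sub h2).congr_deriv (by ring)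
  have hpair : ∀ s, pairing (optPath T c s) (fun u => deriv (fun r => G r u) s +
      (1 / 2) * iteratedDeriv 2 (G s) u) = c * ((heat (T - s) (Γs s) 0 -
        1 / 2 * heat (T - s) (D s) 0) - (heat s (Γs s) 0 - 1 / 2 * heat s (D s) 0)) := by
    intro s
    have i1 := int c1 v1 s
    have i3 := int c3 v3 s
    have i13 : Integrable fun u => deriv (fun r => G r u) s + (1 / 2) * iteratedDeriv 2 (G s) u :=
      i1.add (i3.const_mul (1 / 2))
    rw [pairing_optPath, integral_optDensity_mul T c s i13]
    have e : (fun x => ∫ u in Ioi (-x), (deriv (fun r => G r u) s +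
        (1 / 2) * iteratedDeriv 2 (G s) u)) = fun x => Γs s x + (-(1 / 2)) * D s x := by
      ext x
      have e3 : ∫ u in Ioi (-x), Guu s u = -D s x := by
        rw [tail_integral_eq_intervalIntegral (sl c3 s) (v3 s),
          intervalIntegral.integral_eq_sub_of_hasDerivAt (fun u _ => dGuu s u)
            ((sl c3 s).intervalIntegrable _ _), v2 s M (le_abs_self M)]
        simp [hD]
      have e4 := integral_add (μ := volume.restrict (Ioi (-x))) i1.integrableOn
        (i3.const_mul (1 / 2)).integrableOn
      rw [integral_const_mul, e3] at e4
      exact e4.trans (by simp only [hΓs]; ring)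
    rw [e, heat_add_const_mul (sl cΓs s) (bΓs s) (sl cD s) (bD s),
      heat_add_const_mul (sl cΓs s) (bΓs s) (sl cD s) (bD s)]
    ring
  have hend : ∀ s, pairing (optPath T c s) (G s) =
      c * (heat (T - s) (Γ s) 0 - heat s (Γ s) 0) := fun s => by
    rw [pairing_optPath, integral_optDensity_mul T c s (int c0 v0 s)]
  have k1 := ch (fun s => T - s) cΓs bΓs (by fun_prop)
  have k2 := ch (fun s => T - s) cD bD (by fun_prop)
  have k3 := ch (fun s => s) cΓs bΓs continuous_id
  have k4 := ch (fun s => s) cD bD continuous_id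
  have ftc := intervalIntegral.integral_eq_sub_of_hasDerivAt_of_le (a := 0) (b := T)
    (f := fun r => heat (T - r) (Γ r) 0 - heat r (Γ r) 0) hT
    ((ch (fun s => T - s) cΓ bΓ (by fun_prop)).sub
      (ch (fun s => s) cΓ bΓ continuous_id)).continuousOn dA
    (Continuous.intervalIntegrable (by fun_prop) _ _)
  rw [linPart, hend, hend]
  simp only [hpair]
  -- The forward half solves the heat equation and cancels. In the backward half the two terms with
  -- factor `½` add up to the full derivative `∂_u G`.
  rw [← mul_sub, ← ftc, intervalIntegral.integral_const_mul, ← mul_sub,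
    ← intervalIntegral.integral_sub (Continuous.intervalIntegrable (by fun_prop) _ _)
      (Continuous.intervalIntegrable (by fun_prop) _ _)]
  congr 1
  refine intervalIntegral.integral_congr fun s _ => ?_
  ring

/-- The left side is `l` times the integral of `h` against the heat kernel `p_t`. Young's inequality
and `∫ p_t² = 1 / (2√(πt))` give the bound; the proof works in the rescaled variable `u = -√t z`. -/
theorem mul_heat_reflect_le {t : ℝ} (ht : 0 < t) {h : ℝ → ℝ} (hc : Continuous h)
    (hs : HasCompactSupport h) (l : ℝ) :
    l * heat t (fun x => h (-x)) 0 ≤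
      1 / 2 * (∫ u, h u ^ 2) + l ^ 2 / (4 * √Real.pi) * (√t)⁻¹ := by
  have hr : 0 < √t := Real.sqrt_pos.2 ht
  set k : ℝ → ℝ := fun z => h (-√t * z) with hk
  have kc : Continuous k := hc.comp (by fun_prop)
  have ks : HasCompactSupport k :=
    hs.comp_homeomorph (Homeomorph.mulLeft₀ (-√t) (neg_ne_zero.2 hr.ne'))
  have e1 : heat t (fun x => h (-x)) 0 = ∫ z, gauss z * k z := by
    rw [heat, integral_gaussian]
    congr 1
    ext z
    simp [hk]
  have e2 : ∫ z, k z ^ 2 = (√t)⁻¹ * ∫ u, h u ^ 2 := by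
    have := Measure.integral_comp_mul_left (fun u => h u ^ 2) (-√t)
    rw [this, abs_inv, abs_neg, abs_of_pos hr, smul_eq_mul]
  have i1 : Integrable fun z => gauss z * k z :=
    (continuous_gauss.mul kc).integrable_of_hasCompactSupport ks.mul_left
  have i2 : Integrable fun z => k z ^ 2 :=
    (kc.pow 2).integrable_of_hasCompactSupport (by
      simpa only [pow_two] using ks.mul_left (f := k))
  have key : ∫ z, l * (gauss z * k z) ≤
      ∫ z, (√t / 2 * k z ^ 2 + l ^ 2 / 2 * (√t)⁻¹ * gauss z ^ 2) := by
    refine integral_mono (i1.const_mul l)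
      ((i2.const_mul _).add (integrable_gauss_sq.const_mul _)) fun z => ?_
    have h1 : 0 ≤ (√t)⁻¹ * (√t * k z - l * gauss z) ^ 2 := by positivity
    have h2 : (√t)⁻¹ * (√t * k z - l * gauss z) ^ 2 =
        √t * k z ^ 2 - 2 * (l * (gauss z * k z)) + l ^ 2 * (√t)⁻¹ * gauss z ^ 2 := by
      field_simp
      ring
    dsimp only
    linarith
  rw [integral_const_mul, integral_add (i2.const_mul _) (integrable_gauss_sq.const_mul _),
    integral_const_mul, integral_const_mul, e2, integral_gauss_sq] at key
  rw [e1]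
  refine key.trans (le_of_eq ?_)
  field_simp
  ring

theorem integral_inv_sqrt_sub {T : ℝ} (hT : 0 ≤ T) :
    IntervalIntegrable (fun s => (√(T - s))⁻¹) volume 0 T ∧
      ∫ s in (0 : ℝ)..T, (√(T - s))⁻¹ = 2 * √T := by
  -- At `s = 0` both sides take the default value `0`.
  have e1 : ∀ s ∈ uIcc 0 T, s ^ (-(1 / 2) : ℝ) = (√s)⁻¹ := fun s hs => by
    rw [uIcc_of_le hT] at hs
    rw [Real.rpow_neg hs.1, Real.sqrt_eq_rpow]
  have h1 : IntervalIntegrable (fun s : ℝ => (√s)⁻¹) volume 0 T :=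
    (intervalIntegral.intervalIntegrable_rpow' (r := -(1 / 2)) (by norm_num)).congr
      fun s hs => e1 s (uIoc_subset_uIcc hs)
  constructor
  · simpa using (h1.comp_sub_left T).symm
  · rw [intervalIntegral.integral_comp_sub_left (fun s => (√s)⁻¹), sub_self, sub_zero,
      ← intervalIntegral.integral_congr e1, integral_rpow (Or.inl (by norm_num)),
      Real.sqrt_eq_rpow, Real.zero_rpow (by norm_num)]
    norm_num
    ring

/-- Integrate the fixed-time Young bound over `s`. The kernel's squared norm blows up like `1 / √(T
- s)` as `s` approaches `T`, which is integrable with integral `2√T`. -/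
theorem Qdyn_optPath_le {ρ T : ℝ} (hρ : 0 < ρ * (1 - ρ)) (hT : 0 < T) (l : ℝ) :
    Qdyn ρ T (optPath T (ρ * (1 - ρ) * l)) ≤
      ((ρ * (1 - ρ) * l ^ 2 / 2 * √(T / Real.pi) : ℝ) : EReal) := by
  refine iSup₂_le fun G hG => EReal.coe_le_coe_iff.2 ?_
  obtain ⟨M, hM, hv⟩ := hG.exists_vanish
  have v2 : ∀ s u, M ≤ |s| ∨ M ≤ |u| → deriv (G s) u = 0 := fun s u h => (hv s u h).2.2.1
  obtain ⟨B, hB⟩ := exists_bound_of_vanish (K := fun s u => deriv (G s) u) hG.cont_space v2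
  have sl : ∀ s, Continuous (deriv (G s)) := fun s =>
    hG.cont_space.comp (by fun_prop : Continuous fun u : ℝ => (s, u))
  have sc : ∀ s, HasCompactSupport (deriv (G s)) := fun s =>
    hasCompactSupport_of_vanish fun u hu => v2 s u (Or.inr hu)
  have c1 : Continuous fun s => heat (T - s) (fun x => deriv (G s) (-x)) 0 :=
    continuous_heat (by fun_prop) continuous_const
      (hG.cont_space.comp (by fun_prop : Continuous fun p : ℝ × ℝ => (p.1, -p.2)))
      fun s x => hB s (-x)
  have c2 : Continuous fun s => ∫ u, deriv (G s) u ^ 2 := by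
    have e : ∀ s, ∫ u, deriv (G s) u ^ 2 = ∫ u in (-M)..M, deriv (G s) u ^ 2 := fun s => by
      rw [intervalIntegral.integral_of_le (by linarith), ← integral_Icc_eq_integral_Ioc]
      refine (setIntegral_eq_integral_of_forall_compl_eq_zero fun u hu => ?_).symm
      rw [mem_Icc, ← abs_le, not_le] at hu
      rw [v2 s u (Or.inr hu.le)]
      simp
    simp only [e]
    have c : Continuous (Function.uncurry fun s u => deriv (G s) u ^ 2) :=
      Continuous.pow hG.cont_space 2
    exact intervalIntegral.continuous_parametric_intervalIntegral_of_continuous' (μ := volume)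
      (f := fun s u => deriv (G s) u ^ 2) c _ _
  obtain ⟨hi, he⟩ := integral_inv_sqrt_sub hT.le
  have key : l * (∫ s in (0 : ℝ)..T, heat (T - s) (fun x => deriv (G s) (-x)) 0) ≤
      1 / 2 * (∫ s in (0 : ℝ)..T, ∫ u, deriv (G s) u ^ 2) +
        l ^ 2 / (4 * √Real.pi) * (2 * √T) := by
    rw [← he, ← intervalIntegral.integral_const_mul, ← intervalIntegral.integral_const_mul,
      ← intervalIntegral.integral_const_mul,
      ← intervalIntegral.integral_add ((c2.intervalIntegrable _ _).const_mul _) (hi.const_mul _)]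
    exact intervalIntegral.integral_mono_on_of_le_Ioo hT.le ((c1.intervalIntegrable _ _).const_mul _)
      (((c2.intervalIntegrable _ _).const_mul _).add (hi.const_mul _)) fun s hs =>
        mul_heat_reflect_le (by linarith [hs.2]) (sl s) (sc s) l
  rw [hG.linPart_optPath hT.le, Real.sqrt_div hT.le]
  have h2 := mul_le_mul_of_nonneg_left key hρ.le
  have hp : 0 < √Real.pi := Real.sqrt_pos.2 Real.pi_pos
  have e : ρ * (1 - ρ) * (l ^ 2 / (4 * √Real.pi) * (2 * √T)) =
      ρ * (1 - ρ) * l ^ 2 / 2 * (√T / √Real.pi) := by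
    field_simp
    ring
  linarith

/-! ### Matching the bounds. -/

theorem Q_optPath_le {ρ T : ℝ} (hρ : 0 < ρ * (1 - ρ)) (hT : 0 < T) (l : ℝ) :
    Q ρ T (optPath T (ρ * (1 - ρ) * l)) ≤
      ((ρ * (1 - ρ) * l ^ 2 / 2 * √(2 * T / Real.pi) : ℝ) : EReal) := by
  refine (add_le_add (Qdyn_optPath_le hρ hT l) (Qzero_optPath_le hρ hT l)).trans (le_of_eq ?_)
  rw [← EReal.coe_add]
  congr 1
  ring

theorem rateJ_eq {ρ T : ℝ} (hρ : 0 < ρ * (1 - ρ)) (hT : 0 < T) (a : ℝ) :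
    rateJ ρ T a = ((a ^ 2 / (2 * (ρ * (1 - ρ)) * √(2 * T / Real.pi)) : ℝ) : EReal) := by
  have hK : 0 < √(2 * T / Real.pi) := Real.sqrt_pos.2 (div_pos (by linarith) Real.pi_pos)
  set K := √(2 * T / Real.pi) with hKdef
  have r₀ := left_ne_zero_of_mul hρ.ne'
  have r₁ := right_ne_zero_of_mul hρ.ne'
  rw [rateJ]
  refine le_antisymm ?_ (le_sInf ?_)
  -- The amplitude for which the gain `σ l K` of the optimal path equals `a`.
  · set l := a / (ρ * (1 - ρ) * K) with hl
    have hg := halfLineGain_optPath hT (ρ * (1 - ρ) * l)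
    have e : ρ * (1 - ρ) * l * √(2 * T / Real.pi) = a := by
      rw [← hKdef, hl]
      field_simp
    rw [e] at hg
    refine le_trans (sInf_le ⟨optPath T (ρ * (1 - ρ) * l), isCadlag_optPath T _, hg, rfl⟩)
      ((Q_optPath_le hρ hT l).trans (le_of_eq ?_))
    rw [← hKdef, hl]
    congr 1
    field_simp
  · rintro q ⟨μ, hμ, ha, rfl⟩
    exact le_Q_of_halfLineGain hρ hT hμ ha

theorem rate_const {T : ℝ} (hT : 0 < T) (σ a : ℝ) (hσ : 0 < σ) :
    a ^ 2 / (2 * σ * √(2 * T / Real.pi)) = √(2 * Real.pi) * a ^ 2 / (4 * σ * √T) := by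
  have hp := Real.pi_pos
  have h1 : √(2 * T / Real.pi) * √(2 * Real.pi) = 2 * √T := by
    rw [← Real.sqrt_mul (by positivity), show 2 * T / Real.pi * (2 * Real.pi) = 2 ^ 2 * T by
      field_simp, Real.sqrt_mul (by positivity), Real.sqrt_sq (by norm_num)]
  have h2 : 0 < √(2 * T / Real.pi) := Real.sqrt_pos.2 (by positivity)
  have h3 : 0 < √T := Real.sqrt_pos.2 hT
  rw [div_eq_div_iff (by positivity) (by positivity)]
  linear_combination (-(2 * a ^ 2 * σ)) * h1

end ExclusionMDP

end

theorem theorem2p3 (ρ T α : ℝ) (hρ₀ : 0 < ρ) (hρ₁ : ρ < 1) (hT : 0 < T) :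
    ExclusionMDP.rateJ ρ T α =
        ((√(2 * Real.pi) * α ^ 2 / (4 * ρ * (1 - ρ) * √T) : ℝ) : EReal) ∧
      ExclusionMDP.rateI ρ T α =
        ((√(2 * Real.pi) * ρ * α ^ 2 / (4 * (1 - ρ) * √T) : ℝ) : EReal) := by
  have h1 : 0 < 1 - ρ := by linarith
  have hρ : 0 < ρ * (1 - ρ) := mul_pos hρ₀ h1
  have h2 : 0 < √T := Real.sqrt_pos.2 hT
  constructor
  · rw [ExclusionMDP.rateJ_eq hρ hT, ExclusionMDP.rate_const hT _ _ hρ, mul_assoc 4 ρ]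
  -- The tagged-particle constraint is the current constraint at `ρ * α`, so the two rates agree by
  -- definition.
  · change ExclusionMDP.rateJ ρ T (ρ * α) = _
    rw [ExclusionMDP.rateJ_eq hρ hT, ExclusionMDP.rate_const hT _ _ hρ]
    congr 1
    field_simp
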